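/- Let $D_1,D_2,\dots$ be i.i.d. random elements, let $0<p\le L<\infty$, and for $\gamma\in\mathbb R^p$ put $\tilde\gamma=(\gamma^{T},\mathbf 0^{T})^{T}\in\mathbb R^L$. In the variable-selection setting the full estimating functions are $$g(D,\gamma)=\begin{pmatrix} g_1(D,\tilde\gamma)\\ g_2(D,\tilde\gamma)\end{pmatrix}\in\mathbb R^{L},\qquad g_1(D,\tilde\gamma)\in\mathbb R^{p},\quad g_2(D,\tilde\gamma)\in\mathbb R^{L-p}.$$ Assume that the candidate model is correctly specified with true parameter $\gamma_0\in\mathbb R^p$, i.e. $E\,g(D,\gamma_0)=\mathbf 0$; that $\Sigma_{11}=E\{g(D,\gamma_0)g(D,\gamma_0)^{T}\}$ is positive definite; and that there are a neighbourhood $U$ of $\gamma_0$ and an integrable function $K$ of $D$ such that, almost surely, $\gamma\mapsto g(D,\gamma)$ is twice continuously differentiable on $U$ and $\|\partial g(D,\gamma)/\partial\gamma^{T}\|$, $\|\partial^2 g(D,\gamma)/\partial\gamma^{T}\partial\gamma\|$ and $\|g(D,\gamma)\|^3$ are at most $K(D)$ for all $\gamma\in U$. Let $\Sigma_{12}=E\{\partial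 g(D,\gamma_0)/\partial\gamma^{T}\}$ and assume that $A=E\{\partial g_1(D,\tilde\gamma_0)/\partial\gamma^{T}\}$ is invertible, where $\tilde\gamma_0=(\gamma_0^T,\mathbf 0^T)^T$. Let $\hat\gamma=\hat\gamma_n$ be an estimator of $\gamma_0$ based on the sample of size $n$, and let $\hat\lambda=\hat\lambda_n\in\mathbb R^L$ be a corresponding Lagrange multiplier of the empirical likelihood: whenever the equation $$\frac1n\sum_{i=1}^n\frac{g(D_i,\hat\gamma)}{1+\lambda^{T}g(D_i,\hat\gamma)}=\mathbf 0,\qquad 1+\lambda^{T}g(D_i,\hat\gamma)>0\ \ (i=1,\dots,n),$$ has a solution $\lambda$, $\hat\lambda$ is such a solution. Let $l=\sum_{i=1}^n\log\{1+\hat\lambda^{T}g(D_i,\hat\gamma)\}$ be the negative logarithm of the empirical likelihood ratio at $\hat\gamma$. Consider the expansion $$\hat\gamma-\gamma_0=-A^{-1}\,\frac1n\sum_{i=1}^n g_1(D_i,\tilde\gamma_0)+o_p(n^{-1/2}).\tag{$*$}$$ (a) If $\hat\gamma$ solves $\sum_{i=1}^n g_1(D_i,\tilde\gamma)=\mathbf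 0$ with probability tending to one and $\hat\gamma-\gamma_0=O_p(n^{-1/2})$, then $\hat\gamma$ satisfies $(*)$. (b) If $\hat\gamma$ satisfies $(*)$, then, as $n\to\infty$, $2l$ converges in distribution to $\sum_{j=1}^{\tilde L}\Lambda_j\,\chi^2_{1,j}$, where $\chi^2_{1,1},\dots,\chi^2_{1,\tilde L}$ are independent chi-square variables with one degree of freedom and $\Lambda_1,\dots,\Lambda_{\tilde L}$ are the non-zero eigenvalues, with multiplicity, of $$\Omega=\Sigma_{11}^{1/2}\,\Sigma_*^{T}\,\Sigma_{11}^{-1}\,\Sigma_*\,\Sigma_{11}^{1/2},\qquad \tilde L=\operatorname{rank}(\Omega),\qquad \Sigma_*=I_{L\times L}-\big(\Sigma_{12}A^{-1},\ \mathbf 0_{L\times(L-p)}\big).$$ -/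

import Mathlib

open MeasureTheory ProbabilityTheory Filter Topology
open scoped MatrixOrder

namespace ELCIC

noncomputable section

/-- The padded parameter `(γᵀ, 0ᵀ)ᵀ`: the parameter of the candidate model followed by zeros for
the `q = L - p` parameters that the candidate model leaves out. -/
def pad {p : ℕ} (q : ℕ) (γ : EuclideanSpace ℝ (Fin p)) : EuclideanSpace ℝ (Fin p ⊕ Fin q) :=
  WithLp.toLp 2 (Sum.elim (fun j => γ j) (fun _ => 0))

/-- `γ ↦ g₁(d, (γ, 0))`: the estimating functions of the parameters in the candidate model. -/
def insideEq {𝒟 : Type*} {p q : ℕ}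
    (g₁ : 𝒟 → EuclideanSpace ℝ (Fin p ⊕ Fin q) → EuclideanSpace ℝ (Fin p))
    (d : 𝒟) (γ : EuclideanSpace ℝ (Fin p)) : EuclideanSpace ℝ (Fin p) :=
  g₁ d (pad q γ)

/-- The full estimating functions `g(d, γ) = (g₁(d, (γ, 0)), g₂(d, (γ, 0)))`. -/
def fullEq {𝒟 : Type*} {p q : ℕ}
    (g₁ : 𝒟 → EuclideanSpace ℝ (Fin p ⊕ Fin q) → EuclideanSpace ℝ (Fin p))
    (g₂ : 𝒟 → EuclideanSpace ℝ (Fin p ⊕ Fin q) → EuclideanSpace ℝ (Fin q))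
    (d : 𝒟) (γ : EuclideanSpace ℝ (Fin p)) : EuclideanSpace ℝ (Fin p ⊕ Fin q) :=
  WithLp.toLp 2 (Sum.elim (fun j => g₁ d (pad q γ) j) (fun j => g₂ d (pad q γ) j))

/-- The expected Jacobian `E[∂f(D, γ₀)/∂γᵀ]`, where `ν` is the law of `D`. -/
def meanJacobian {𝒟 ι : Type*} [MeasurableSpace 𝒟] [Fintype ι] {p : ℕ} (ν : Measure 𝒟)
    (f : 𝒟 → EuclideanSpace ℝ (Fin p) → EuclideanSpace ℝ ι) (γ₀ : EuclideanSpace ℝ (Fin p)) :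
    Matrix ι (Fin p) ℝ :=
  Matrix.of fun i j => ∫ d, fderiv ℝ (f d) γ₀ (EuclideanSpace.single j 1) i ∂ν

/-- The second moment matrix `E[f(D, γ₀) f(D, γ₀)ᵀ]`, where `ν` is the law of `D`. -/
def secondMoment {𝒟 ι : Type*} [MeasurableSpace 𝒟] [Fintype ι] {p : ℕ} (ν : Measure 𝒟)
    (f : 𝒟 → EuclideanSpace ℝ (Fin p) → EuclideanSpace ℝ ι) (γ₀ : EuclideanSpace ℝ (Fin p)) :
    Matrix ι ι ℝ :=
  Matrix.of fun i j => ∫ d, f d γ₀ i * f d γ₀ j ∂ν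

/-- The regularity condition on the estimating functions at the true parameter `γ₀`. -/
structure Regular {𝒟 ι : Type*} [MeasurableSpace 𝒟] [Fintype ι] {p : ℕ} (ν : Measure 𝒟)
    (f : 𝒟 → EuclideanSpace ℝ (Fin p) → EuclideanSpace ℝ ι) (γ₀ : EuclideanSpace ℝ (Fin p)) :
    Prop where
  mean_zero : ∫ d, f d γ₀ ∂ν = 0
  posDef : (secondMoment ν f γ₀).PosDef
  smooth_bounded : ∃ U : Set (EuclideanSpace ℝ (Fin p)), IsOpen U ∧ γ₀ ∈ U ∧
    (∀ᵐ d ∂ν, ContDiffOn ℝ 2 (f d) U) ∧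
    ∃ K : 𝒟 → ℝ, Integrable K ν ∧ ∀ᵐ d ∂ν, ∀ γ ∈ U,
      ‖fderiv ℝ (f d) γ‖ ≤ K d ∧ ‖iteratedFDeriv ℝ 2 (f d) γ‖ ≤ K d ∧ ‖f d γ‖ ^ 3 ≤ K d

/-- `lam` solves the Lagrange multiplier equation of the empirical likelihood for the points
`x₁, …, xₙ`. The positivity says that the weights `1 / (n (1 + lamᵀ xᵢ))` are positive. -/
def IsMultiplier {ι : Type*} [Fintype ι] {n : ℕ} (x : Fin n → EuclideanSpace ℝ ι)
    (lam : EuclideanSpace ℝ ι) : Prop :=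
  (∀ i, 0 < 1 + inner ℝ lam (x i)) ∧
    (n : ℝ)⁻¹ • ∑ i, (1 + inner ℝ lam (x i))⁻¹ • x i = 0

/-- The negative log empirical likelihood ratio `∑ᵢ log (1 + lamᵀ xᵢ)`. -/
def negLogEL {ι : Type*} [Fintype ι] {n : ℕ} (x : Fin n → EuclideanSpace ℝ ι)
    (lam : EuclideanSpace ℝ ι) : ℝ :=
  ∑ i, Real.log (1 + inner ℝ lam (x i))

/-- `Σ_* = I - (Σ₁₂ A⁻¹, 0)` with `Σ₁₂ = E[∂g(D, γ₀)/∂γᵀ]`, `A = E[∂g₁(D, (γ₀, 0))/∂γᵀ]`. -/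
def sigmaStar {𝒟 : Type*} [MeasurableSpace 𝒟] {p q : ℕ} (ν : Measure 𝒟)
    (g₁ : 𝒟 → EuclideanSpace ℝ (Fin p ⊕ Fin q) → EuclideanSpace ℝ (Fin p))
    (g₂ : 𝒟 → EuclideanSpace ℝ (Fin p ⊕ Fin q) → EuclideanSpace ℝ (Fin q))
    (γ₀ : EuclideanSpace ℝ (Fin p)) : Matrix (Fin p ⊕ Fin q) (Fin p ⊕ Fin q) ℝ :=
  1 - Matrix.fromCols
    (meanJacobian ν (fullEq g₁ g₂) γ₀ * (meanJacobian ν (insideEq g₁) γ₀)⁻¹) 0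

/-- `Ω = Σ₁₁^{1/2} Σ_*ᵀ Σ₁₁⁻¹ Σ_* Σ₁₁^{1/2}`. -/
def omegaMatrix {𝒟 : Type*} [MeasurableSpace 𝒟] {p q : ℕ} (ν : Measure 𝒟)
    (g₁ : 𝒟 → EuclideanSpace ℝ (Fin p ⊕ Fin q) → EuclideanSpace ℝ (Fin p))
    (g₂ : 𝒟 → EuclideanSpace ℝ (Fin p ⊕ Fin q) → EuclideanSpace ℝ (Fin q))
    (γ₀ : EuclideanSpace ℝ (Fin p)) : Matrix (Fin p ⊕ Fin q) (Fin p ⊕ Fin q) ℝ :=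
  CFC.sqrt (secondMoment ν (fullEq g₁ g₂) γ₀) * (sigmaStar ν g₁ g₂ γ₀).transpose *
    (secondMoment ν (fullEq g₁ g₂) γ₀)⁻¹ * sigmaStar ν g₁ g₂ γ₀ *
    CFC.sqrt (secondMoment ν (fullEq g₁ g₂) γ₀)

/-- `X n = O_p(1)`. -/
def BoundedInProbability {Ω E : Type*} [MeasurableSpace Ω] [Norm E] (P : Measure Ω)
    (X : ℕ → Ω → E) : Prop :=
  ∀ ε : ENNReal, 0 < ε → ∃ M : ℝ, ∀ᶠ n in atTop, P {ω | M < ‖X n ω‖} ≤ ε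

/-- The linear expansion
`γhat - γ₀ = -A⁻¹ (1/n) ∑ᵢ g₁(Dᵢ, (γ₀, 0)) + o_p(n^{-1/2})`, `A = E[∂g₁(D, (γ₀, 0))/∂γᵀ]`. -/
def LinearExpansion {Ω 𝒟 : Type*} [MeasurableSpace Ω] [MeasurableSpace 𝒟] {p q : ℕ}
    (P : Measure Ω) (ν : Measure 𝒟) (D : ℕ → Ω → 𝒟)
    (g₁ : 𝒟 → EuclideanSpace ℝ (Fin p ⊕ Fin q) → EuclideanSpace ℝ (Fin p))
    (γ₀ : EuclideanSpace ℝ (Fin p)) (γhat : ℕ → Ω → EuclideanSpace ℝ (Fin p)) : Prop :=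
  TendstoInMeasure P
    (fun (n : ℕ) ω => Real.sqrt n • (γhat n ω - γ₀ +
      Matrix.toEuclideanLin (meanJacobian ν (insideEq g₁) γ₀)⁻¹
        ((n : ℝ)⁻¹ • ∑ i : Fin n, insideEq g₁ (D i ω) γ₀)))
    atTop (fun _ => 0)

/-- The chi-square distribution with one degree of freedom: the law of the square of a standard
normal variable. -/
def chiSqOne : Measure ℝ := (gaussianReal 0 1).map (fun x => x ^ 2)

instance : IsProbabilityMeasure chiSqOne :=
  Measure.isProbabilityMeasure_map (by fun_prop)

end

end ELCIC

open ELCIC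

/-!
# The limit law of the empirical likelihood ratio at a plug-in estimator

Write `Zₙ = n^{-1/2} ∑ᵢ g(Dᵢ, γ₀)` and `uₙ = n^{-1/2} ∑ᵢ g(Dᵢ, γhat)`. A second order Taylor
expansion with an integrable envelope and the law of large numbers give
`uₙ = Zₙ + Σ₁₂ √n (γhat - γ₀) + o_p(1)` for every root-n consistent `γhat`
(`tendstoInMeasure_rootMean_sub`). If `γhat` solves the equations of `g₁`, the first `p` coordinates
of this identity can be solved for `√n (γhat - γ₀)`, which is the linear expansion
(`linearExpansion_of_solves`). Conversely, inserting the linear expansion gives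
`uₙ = Σ_* Zₙ + o_p(1)`.

The likelihood ratio is handled by a deterministic statement about points `x₁, …, xₙ` with small
mean `m`. The concave function `F(λ) = ∑ᵢ log (1 + λᵀ xᵢ)` lies close to the quadratic
`n (λᵀ m - λᵀ Σ₁₁ λ / 2)` on a small ball. Hence it is negative on the boundary of the ball, so
it has a critical point inside: a multiplier exists (`exists_isMultiplier`). Every multiplier is
`O(‖m‖)` (`IsMultiplier.norm_le`) and maximizes `F`, so that `2 F` at the multiplier agrees with
the maximum `n mᵀ Σ₁₁⁻¹ m` of twice the quadratic
(`IsMultiplier.abs_two_mul_negLogEL_sub_le`). With `xᵢ = g(Dᵢ, γhat)` this reads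
`2 l = uₙᵀ Σ₁₁⁻¹ uₙ + o_p(1)` (`tendstoInMeasure_two_mul_negLogEL_sub`).

By the central limit theorem and the continuous mapping theorem, `2 l` converges in distribution to
`zᵀ Ω z` for a standard Gaussian vector `z`, and diagonalizing `Ω` turns this into the weighted sum
of independent `χ²₁` variables (`exists_map_stdGaussian_inner_eq`).
-/

namespace ELCIC

/-! ### The empirical likelihood of a fixed sample -/

lemma abs_two_mul_log_one_add_sub_le {t : ℝ} (ht : |t| ≤ 1 / 2) :
    |2 * Real.log (1 + t) - (2 * t - t ^ 2)| ≤ 4 * |t| ^ 3 := by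
  have h := Real.abs_log_sub_add_sum_range_le (x := -t) (by rw [abs_neg]; linarith) 2
  rw [abs_neg, sub_neg_eq_add] at h
  have h2 : |t| ^ (2 + 1) / (1 - |t|) ≤ 2 * |t| ^ 3 := by
    rw [div_le_iff₀ (by linarith)]
    have := mul_nonneg (pow_nonneg (abs_nonneg t) 3) (sub_nonneg.2 ht)
    linarith [pow_succ |t| 2]
  have h3 := h.trans h2
  simp only [Finset.sum_range_succ, Finset.sum_range_zero] at h3
  rw [abs_le] at h3 ⊢
  constructor <;> norm_num at h3 ⊢ <;> nlinarith

section Sample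

variable {ι : Type*} [Fintype ι] {n : ℕ} {x : Fin n → EuclideanSpace ℝ ι}
  {T : EuclideanSpace ℝ ι →ₗ[ℝ] EuclideanSpace ℝ ι} {c η M : ℝ}

/-- The multiplier equation, tested against a vector. -/
lemma IsMultiplier.sum_inner_eq_zero {lam : EuclideanSpace ℝ ι} (hn : 0 < n)
    (h : IsMultiplier x lam) (v : EuclideanSpace ℝ ι) :
    ∑ i, (1 + inner ℝ lam (x i))⁻¹ * inner ℝ v (x i) = 0 := by
  have h1 : ∑ i, (1 + inner ℝ lam (x i))⁻¹ • x i = 0 := by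
    have := h.2
    rwa [smul_eq_zero_iff_right (by positivity)] at this
  have h2 := congrArg (fun y => inner ℝ v y) h1
  simpa [inner_sum, inner_smul_right] using h2

/-- By concavity of the logarithm, a multiplier maximizes `∑ᵢ log (1 + lamᵀ xᵢ)` over the
`lam` for which all the terms are defined. -/
lemma IsMultiplier.negLogEL_le {lam lam' : EuclideanSpace ℝ ι} (hn : 0 < n)
    (h : IsMultiplier x lam) (h' : ∀ i, 0 < 1 + inner ℝ lam' (x i)) :
    negLogEL x lam' ≤ negLogEL x lam := by
  have h0 := h.sum_inner_eq_zero hn (lam' - lam)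
  have hle : ∀ i, Real.log (1 + inner ℝ lam' (x i)) - Real.log (1 + inner ℝ lam (x i)) ≤
      (1 + inner ℝ lam (x i))⁻¹ * inner ℝ (lam' - lam) (x i) := by
    intro i
    have hp := h.1 i
    rw [← Real.log_div (h' i).ne' hp.ne']
    refine (Real.log_le_sub_one_of_pos (div_pos (h' i) hp)).trans (le_of_eq ?_)
    rw [inner_sub_left]
    field_simp
    ring
  have := Finset.sum_le_sum fun i (_ : i ∈ Finset.univ) => hle i
  rw [h0, Finset.sum_sub_distrib] at this
  unfold negLogEL
  linarith

lemma sum_inner_eq_mul_inner_mean (hn : 0 < n) (lam : EuclideanSpace ℝ ι) :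
    ∑ i, inner ℝ lam (x i) = n * inner ℝ lam ((n : ℝ)⁻¹ • ∑ i, x i) := by
  have : (n : ℝ) ≠ 0 := by positivity
  rw [inner_smul_right, inner_sum, mul_inv_cancel_left₀ this]

lemma abs_inner_le_of_norm_le (hxM : ∀ i, ‖x i‖ ≤ M) {lam : EuclideanSpace ℝ ι} {r : ℝ}
    (hr : ‖lam‖ ≤ r) (i : Fin n) : |inner ℝ lam (x i)| ≤ r * M :=
  (abs_real_inner_le_norm _ _).trans
    (mul_le_mul hr (hxM i) (norm_nonneg _) ((norm_nonneg _).trans hr))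

/-- Third order expansion of the log empirical likelihood near `lam = 0`. -/
lemma abs_two_mul_negLogEL_sub_le (hxM : ∀ i, ‖x i‖ ≤ M)
    {lam : EuclideanSpace ℝ ι} {r : ℝ} (hr : ‖lam‖ ≤ r) (hrM : r * M ≤ 1 / 2) :
    |2 * negLogEL x lam - (2 * ∑ i, inner ℝ lam (x i) - ∑ i, inner ℝ lam (x i) ^ 2)| ≤
      4 * (r * M) * ∑ i, inner ℝ lam (x i) ^ 2 := by
  have ht := abs_inner_le_of_norm_le hxM hr
  have : 2 * negLogEL x lam - (2 * ∑ i, inner ℝ lam (x i) - ∑ i, inner ℝ lam (x i) ^ 2) =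
      ∑ i, (2 * Real.log (1 + inner ℝ lam (x i)) -
        (2 * inner ℝ lam (x i) - inner ℝ lam (x i) ^ 2)) := by
    simp only [negLogEL, Finset.sum_sub_distrib, Finset.mul_sum]
  rw [this, Finset.mul_sum]
  refine (Finset.abs_sum_le_sum_abs _ _).trans (Finset.sum_le_sum fun i _ => ?_)
  refine (abs_two_mul_log_one_add_sub_le ((ht i).trans hrM)).trans ?_
  have h3 : |inner ℝ lam (x i)| ^ 3 = |inner ℝ lam (x i)| * inner ℝ lam (x i) ^ 2 := by
    rw [← sq_abs (inner ℝ lam (x i))]; ring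
  rw [h3, mul_assoc]
  have := mul_le_mul_of_nonneg_right (ht i) (sq_nonneg (inner ℝ lam (x i)))
  linarith

/-- If the mean of the sample is small compared with the smallest eigenvalue of its second moment
matrix, the multiplier equation has a solution: `∑ᵢ log (1 + lamᵀ xᵢ)` is negative on a sphere
around the origin, so it has a local maximum inside. -/
lemma exists_isMultiplier (hn : 0 < n) (hM : 0 < M) (hxM : ∀ i, ‖x i‖ ≤ M)
    (hlow : ∀ lam : EuclideanSpace ℝ ι, n * (c / 2 * ‖lam‖ ^ 2) ≤ ∑ i, inner ℝ lam (x i) ^ 2)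
    (hm : 64 * M * ‖(n : ℝ)⁻¹ • ∑ i, x i‖ < c) : ∃ lam, IsMultiplier x lam := by
  set m := (n : ℝ)⁻¹ • ∑ i, x i with hmdef
  -- On the ball of radius `1 / (8 M)` the third order remainder is at most half of the quadratic
  -- term.
  set r : ℝ := 1 / (8 * M) with hrdef
  have hrM : r * M = 1 / 8 := by rw [hrdef]; field_simp
  have hr : 0 < r := by positivity
  have hn' : (0 : ℝ) < n := by positivity
  have ht : ∀ lam : EuclideanSpace ℝ ι, ‖lam‖ ≤ r → ∀ i, |inner ℝ lam (x i)| ≤ 1 / 8 :=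
    fun lam hl i => hrM ▸ abs_inner_le_of_norm_le hxM hl i
  have hpos : ∀ lam : EuclideanSpace ℝ ι, ‖lam‖ ≤ r → ∀ i, 0 < 1 + inner ℝ lam (x i) := by
    intro lam hl i
    have := (abs_le.1 (ht lam hl i)).1
    linarith
  have hcont : ContinuousOn (negLogEL x) (Metric.closedBall 0 r) := by
    unfold negLogEL
    refine continuousOn_finsetSum _ fun i _ => ContinuousOn.log (by fun_prop) ?_
    intro lam hl
    exact (hpos lam (by simpa using hl) i).ne'
  obtain ⟨lam, hlam, hmax⟩ := (isCompact_closedBall (0 : EuclideanSpace ℝ ι) r).exists_isMaxOn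
    ⟨0, by simp [hr.le]⟩ hcont
  have h0 : 0 ≤ negLogEL x lam := by
    have h00 := hmax (show (0 : EuclideanSpace ℝ ι) ∈ Metric.closedBall 0 r by simp [hr.le])
    simpa [negLogEL] using h00
  have hle : ‖lam‖ ≤ r := by simpa using hlam
  have hlt : ‖lam‖ < r := by
    refine lt_of_le_of_ne hle fun heq => ?_
    have h1 := (abs_le.1 (abs_two_mul_negLogEL_sub_le hxM hle (by rw [hrM]; norm_num))).2
    rw [sum_inner_eq_mul_inner_mean hn, hrM] at h1
    have h2 := hlow lam
    have h3 : inner ℝ lam m ≤ r * ‖m‖ := (real_inner_le_norm _ _).trans (by rw [heq])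
    have h4 : n * inner ℝ lam m ≤ n * (r * ‖m‖) := by gcongr
    rw [heq] at h2
    have h5 : ‖m‖ < c * r / 8 := by
      rw [hrdef]; field_simp; linarith
    have h6 : n * (r * ‖m‖) < n * (r * (c * r / 8)) := by gcongr
    nlinarith
  refine ⟨lam, hpos lam hle, ?_⟩
  have hloc : IsLocalMax (negLogEL x) lam := by
    refine hmax.isLocalMax ?_
    exact Metric.closedBall_mem_nhds_of_mem (by simpa using hlt)
  have hder : HasFDerivAt (negLogEL x)
      (∑ i, (1 + inner ℝ lam (x i))⁻¹ • innerSL ℝ (x i)) lam := by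
    unfold negLogEL
    refine HasFDerivAt.fun_sum fun i _ => ?_
    refine HasFDerivAt.log ?_ (hpos lam hle i).ne'
    have : HasFDerivAt (fun l : EuclideanSpace ℝ ι => 1 + inner ℝ (x i) l)
      (innerSL ℝ (x i)) lam := ((innerSL ℝ (x i)).hasFDerivAt).const_add 1
    simpa only [real_inner_comm] using this
  have hz := hloc.hasFDerivAt_eq_zero hder
  have : ∑ i, (1 + inner ℝ lam (x i))⁻¹ • x i = 0 := by
    refine ext_inner_left ℝ fun v => ?_
    have := congrArg (fun L => L v) hz
    simpa [inner_sum, inner_smul_right, real_inner_comm] using this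
  rw [this, smul_zero]

/-- Every multiplier is of the order of the mean of the sample. -/
lemma IsMultiplier.norm_le {lam : EuclideanSpace ℝ ι} (h : IsMultiplier x lam) (hn : 0 < n)
    (hM : 0 < M) (hxM : ∀ i, ‖x i‖ ≤ M) (hc : 0 < c)
    (hlow : ∀ lam : EuclideanSpace ℝ ι, n * (c / 2 * ‖lam‖ ^ 2) ≤ ∑ i, inner ℝ lam (x i) ^ 2)
    (hm : 64 * M * ‖(n : ℝ)⁻¹ • ∑ i, x i‖ < c) :
    ‖lam‖ ≤ 4 * ‖(n : ℝ)⁻¹ • ∑ i, x i‖ / c := by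
  set m := (n : ℝ)⁻¹ • ∑ i, x i with hmdef
  have hn' : (0 : ℝ) < n := by positivity
  have hD : 0 < 1 + ‖lam‖ * M := by positivity
  -- Test the multiplier equation against `lam`, with `t / (1 + t) = t - t² / (1 + t)`.
  have h1 : ∑ i, (inner ℝ lam (x i) - inner ℝ lam (x i) ^ 2 / (1 + ‖lam‖ * M)) ≥ 0 := by
    rw [ge_iff_le, ← h.sum_inner_eq_zero hn lam]
    refine Finset.sum_le_sum fun i _ => ?_
    have hp := h.1 i
    have hb : 1 + inner ℝ lam (x i) ≤ 1 + ‖lam‖ * M := by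
      linarith [(abs_le.1 (abs_inner_le_of_norm_le hxM le_rfl (lam := lam) i)).2]
    have hq : inner ℝ lam (x i) ^ 2 / (1 + ‖lam‖ * M) ≤
        inner ℝ lam (x i) ^ 2 / (1 + inner ℝ lam (x i)) := by gcongr
    have he : (1 + inner ℝ lam (x i))⁻¹ * inner ℝ lam (x i) =
        inner ℝ lam (x i) - inner ℝ lam (x i) ^ 2 / (1 + inner ℝ lam (x i)) := by
      field_simp
      ring
    linarith
  rw [Finset.sum_sub_distrib, ← Finset.sum_div, sum_inner_eq_mul_inner_mean hn] at h1
  have h2 : ∑ i, inner ℝ lam (x i) ^ 2 ≤ n * inner ℝ lam m * (1 + ‖lam‖ * M) := by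
    rw [← div_le_iff₀ hD]; linarith
  have h3 : inner ℝ lam m ≤ ‖lam‖ * ‖m‖ := real_inner_le_norm _ _
  have h4 : n * (c / 2 * ‖lam‖ ^ 2) ≤ n * (‖lam‖ * ‖m‖ * (1 + ‖lam‖ * M)) :=
    ((hlow lam).trans h2).trans (by rw [mul_assoc]; gcongr)
  have h5 := le_of_mul_le_mul_left h4 hn'
  rcases (norm_nonneg lam).eq_or_lt with h0 | h0
  · rw [← h0]; positivity
  have h6 : c / 2 * ‖lam‖ ≤ ‖m‖ * (1 + ‖lam‖ * M) := by
    refine le_of_mul_le_mul_left ?_ h0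
    linarith
  rw [le_div_iff₀ hc]
  nlinarith [norm_nonneg m]

/-- The second moments of the sample are bounded below if they are close to those of `T`. -/
lemma mul_norm_sq_le_sum_inner_sq (hη : η ≤ c / 2)
    (hTc : ∀ v, c * ‖v‖ ^ 2 ≤ inner ℝ v (T v))
    (hTη : ∀ v : EuclideanSpace ℝ ι,
      |∑ i, inner ℝ v (x i) ^ 2 - n * inner ℝ v (T v)| ≤ n * (η * ‖v‖ ^ 2))
    (v : EuclideanSpace ℝ ι) : n * (c / 2 * ‖v‖ ^ 2) ≤ ∑ i, inner ℝ v (x i) ^ 2 := by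
  have h1 := (abs_le.1 (hTη v)).1
  have h2 : n * (c * ‖v‖ ^ 2) ≤ n * inner ℝ v (T v) := by gcongr; exact hTc v
  have h3 : n * (η * ‖v‖ ^ 2) ≤ n * (c / 2 * ‖v‖ ^ 2) := by gcongr
  nlinarith

/-- The log empirical likelihood ratio of a sample with mean `m` and second moment matrix close to
`T` is `n mᵀ T⁻¹ m / 2`, up to an explicit error. -/
lemma IsMultiplier.abs_two_mul_negLogEL_sub_le {C : ℝ} {lam w : EuclideanSpace ℝ ι}
    (h : IsMultiplier x lam) (hn : 0 < n)
    (hM : 0 < M) (hxM : ∀ i, ‖x i‖ ≤ M) (hc : 0 < c) (hη0 : 0 ≤ η) (hη : η ≤ c / 2)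
    (hC : 0 ≤ C)
    (hT : T.IsSymmetric) (hTc : ∀ v, c * ‖v‖ ^ 2 ≤ inner ℝ v (T v))
    (hTC : ∀ v, inner ℝ v (T v) ≤ C * ‖v‖ ^ 2)
    (hTη : ∀ v : EuclideanSpace ℝ ι,
      |∑ i, inner ℝ v (x i) ^ 2 - n * inner ℝ v (T v)| ≤ n * (η * ‖v‖ ^ 2))
    (hm : 64 * M * ‖(n : ℝ)⁻¹ • ∑ i, x i‖ < c) (hw : T w = (n : ℝ)⁻¹ • ∑ i, x i) :
    |2 * negLogEL x lam - n * inner ℝ w ((n : ℝ)⁻¹ • ∑ i, x i)| ≤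
      n * (η * (4 * ‖(n : ℝ)⁻¹ • ∑ i, x i‖ / c) ^ 2 +
        4 * M * (C + η) * (4 * ‖(n : ℝ)⁻¹ • ∑ i, x i‖ / c) ^ 3) := by
  have hn' : (0 : ℝ) < n := by positivity
  have hlow := mul_norm_sq_le_sum_inner_sq hη hTc hTη
  have hlam := h.norm_le hn hM hxM hc hlow hm
  set m := (n : ℝ)⁻¹ • ∑ i, x i with hmdef
  set ρ := 4 * ‖m‖ / c with hρ
  have hρ0 : 0 ≤ ρ := by positivity
  have hρM : ρ * M ≤ 1 / 16 := by
    rw [hρ, div_mul_eq_mul_div, div_le_iff₀ hc]; linarith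
  have hwρ : ‖w‖ ≤ ρ := by
    have h1 : c * ‖w‖ ^ 2 ≤ ‖w‖ * ‖m‖ := (hTc w).trans (hw ▸ real_inner_le_norm _ _)
    rcases (norm_nonneg w).eq_or_lt with h0 | h0
    · rw [← h0]; exact hρ0
    rw [hρ, le_div_iff₀ hc]
    have : c * ‖w‖ ≤ ‖m‖ := le_of_mul_le_mul_left (by linarith) h0
    nlinarith [norm_nonneg m]
  have key : ∀ v : EuclideanSpace ℝ ι, ‖v‖ ≤ ρ →
      |2 * negLogEL x v - n * (2 * inner ℝ v m - inner ℝ v (T v))| ≤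
        n * (η * ρ ^ 2 + 4 * M * (C + η) * ρ ^ 3) := by
    intro v hv
    have h1 := ELCIC.abs_two_mul_negLogEL_sub_le hxM hv (by linarith)
    rw [sum_inner_eq_mul_inner_mean hn] at h1
    have h2 := hTη v
    have hv2 : ‖v‖ ^ 2 ≤ ρ ^ 2 := by gcongr
    have h3 : ∑ i, inner ℝ v (x i) ^ 2 ≤ n * ((C + η) * ρ ^ 2) := by
      have h3 := (abs_le.1 h2).2
      have h4 : n * inner ℝ v (T v) ≤ n * (C * ‖v‖ ^ 2) := by gcongr; exact hTC v
      have h5 : n * ((C + η) * ‖v‖ ^ 2) ≤ n * ((C + η) * ρ ^ 2) := by gcongr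
      linarith
    have h4 : 4 * (ρ * M) * ∑ i, inner ℝ v (x i) ^ 2 ≤ 4 * (ρ * M) * (n * ((C + η) * ρ ^ 2)) := by
      gcongr
    have h5 : n * (η * ‖v‖ ^ 2) ≤ n * (η * ρ ^ 2) := by gcongr
    rw [abs_le] at h1 h2 ⊢
    constructor <;> nlinarith
  -- The quadratic approximation `2 vᵀ m - vᵀ T v` is maximal at `v = w`, with value `wᵀ m`.
  have hquad : ∀ v, 2 * inner ℝ v m - inner ℝ v (T v) =
      inner ℝ w m - inner ℝ (v - w) (T (v - w)) := by
    intro v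
    have h1 : inner ℝ w (T v) = inner ℝ v m := by rw [← hw, ← hT w v, real_inner_comm]
    rw [map_sub, inner_sub_left, inner_sub_right, inner_sub_right, h1, hw]
    ring
  have hup : 2 * inner ℝ lam m - inner ℝ lam (T lam) ≤ inner ℝ w m := by
    rw [hquad]
    have := hTc (lam - w)
    have : 0 ≤ c * ‖lam - w‖ ^ 2 := by positivity
    linarith
  have hwq : 2 * inner ℝ w m - inner ℝ w (T w) = inner ℝ w m := by rw [hw]; ring
  have hwpos : ∀ i, 0 < 1 + inner ℝ w (x i) := by
    intro i
    have := (abs_le.1 (abs_inner_le_of_norm_le hxM hwρ i)).1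
    linarith
  have h1 := (abs_le.1 (key lam hlam)).2
  have h2 := (abs_le.1 (key w hwρ)).1
  have h3 := h.negLogEL_le hn hwpos
  have h4 := mul_le_mul_of_nonneg_left hup hn'.le
  rw [hwq] at h2
  rw [abs_le]
  constructor <;> linarith

end Sample

/-! ### Stochastic order symbols -/

section Order

variable {Ω E F : Type*} [MeasurableSpace Ω] [NormedAddCommGroup E] [NormedAddCommGroup F]
  {P : Measure Ω}

/-- The way in which negligible remainders are identified: if `c` is as small as desired where `a`
is small and `b` is bounded, on events `G n` with probability tending to one, then `a = o_p(1)` and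
`b = O_p(1)` imply `c = o_p(1)`. -/
lemma tendstoInMeasure_zero_of_control {a b : ℕ → Ω → ℝ} {c : ℕ → Ω → E} {G : ℕ → Set Ω}
    (ha : TendstoInMeasure P a atTop (fun _ => 0)) (hb : BoundedInProbability P b)
    (hG : Tendsto (fun n => P (G n)ᶜ) atTop (𝓝 0))
    (h : ∀ B ε : ℝ, 0 < ε → ∃ δ > 0, ∀ᶠ n in atTop, ∀ᵐ ω ∂P, ω ∈ G n →
      |a n ω| < δ → |b n ω| ≤ B → ‖c n ω‖ < ε) :
    TendstoInMeasure P c atTop (fun _ => 0) := by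
  rw [tendstoInMeasure_iff_norm] at ha ⊢
  intro ε hε
  rw [ENNReal.tendsto_nhds_zero]
  intro e he
  have he3 : 0 < e / 3 := ENNReal.div_pos he.ne' (by norm_num)
  obtain ⟨B, hB⟩ := hb (e / 3) he3
  obtain ⟨δ, hδ, hn⟩ := h B ε hε
  have ha' := (ENNReal.tendsto_nhds_zero.1 (ha δ hδ)) (e / 3) he3
  have hG' := (ENNReal.tendsto_nhds_zero.1 hG) (e / 3) he3
  filter_upwards [hB, hn, ha', hG'] with n h1 h2 h3 h4
  have hsub : P {ω | ε ≤ ‖c n ω - 0‖} ≤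
      P ((G n)ᶜ ∪ ({ω | δ ≤ ‖a n ω - 0‖} ∪ {ω | B < ‖b n ω‖})) := by
    refine measure_mono_ae ?_
    filter_upwards [h2] with ω hω
    intro (hc : ε ≤ ‖c n ω - 0‖)
    change ω ∈ (G n)ᶜ ∪ ({ω | δ ≤ ‖a n ω - 0‖} ∪ {ω | B < ‖b n ω‖})
    by_contra hcon
    simp only [Set.mem_union, Set.mem_compl_iff, Set.mem_ofPred_eq, not_or, not_not, not_le,
      not_lt, sub_zero, Real.norm_eq_abs] at hcon hc
    exact absurd (hω hcon.1 hcon.2.1 hcon.2.2) (not_lt.2 hc)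
  calc P {ω | ε ≤ ‖c n ω - 0‖} ≤ _ := hsub
    _ ≤ e / 3 + (e / 3 + e / 3) :=
      (measure_union_le _ _).trans (add_le_add h4 ((measure_union_le _ _).trans (add_le_add h3 h1)))
    _ = e := by rw [← add_assoc, ENNReal.add_thirds]

lemma BoundedInProbability.mono {X : ℕ → Ω → E} {Y : ℕ → Ω → F} (hX : BoundedInProbability P X)
    (h : ∀ n ω, ‖Y n ω‖ ≤ ‖X n ω‖) : BoundedInProbability P Y := by
  intro ε hε
  obtain ⟨M, hM⟩ := hX ε hε
  refine ⟨M, hM.mono fun n hn => (measure_mono fun ω hω => ?_).trans hn⟩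
  exact lt_of_lt_of_le hω (h n ω)

lemma BoundedInProbability.norm_add_norm {X : ℕ → Ω → E} {Y : ℕ → Ω → F}
    (hX : BoundedInProbability P X) (hY : BoundedInProbability P Y) :
    BoundedInProbability P (fun n ω => ‖X n ω‖ + ‖Y n ω‖) := by
  intro ε hε
  obtain ⟨M, hM⟩ := hX (ε / 2) (ENNReal.half_pos hε.ne')
  obtain ⟨N, hN⟩ := hY (ε / 2) (ENNReal.half_pos hε.ne')
  refine ⟨M + N, ?_⟩
  filter_upwards [hM, hN] with n h1 h2
  refine (measure_mono (fun ω hω => ?_)).trans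
    ((measure_union_le _ _).trans ((add_le_add h1 h2).trans (ENNReal.add_halves ε).le))
  simp only [Set.mem_ofPred_eq, Set.mem_union] at hω ⊢
  rw [Real.norm_of_nonneg (by positivity)] at hω
  by_contra! hcon
  linarith [hcon.1, hcon.2]

lemma BoundedInProbability.add {X Y : ℕ → Ω → E}
    (hX : BoundedInProbability P X) (hY : BoundedInProbability P Y) :
    BoundedInProbability P (fun n ω => X n ω + Y n ω) :=
  (hX.norm_add_norm hY).mono fun n ω => by
    rw [Real.norm_of_nonneg (by positivity)]; exact norm_add_le _ _

lemma BoundedInProbability.clm [NormedSpace ℝ E] [NormedSpace ℝ F] {X : ℕ → Ω → E}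
    (hX : BoundedInProbability P X) (L : E →L[ℝ] F) :
    BoundedInProbability P (fun n ω => L (X n ω)) := by
  intro ε hε
  obtain ⟨M, hM⟩ := hX ε hε
  refine ⟨‖L‖ * M, hM.mono fun n hn => (measure_mono fun ω hω => ?_).trans hn⟩
  simp only [Set.mem_ofPred_eq] at hω ⊢
  by_contra! hcon
  exact absurd (hω.trans_le (L.le_opNorm _)) (not_lt.2 (by gcongr))

lemma BoundedInProbability.norm {X : ℕ → Ω → E} (hX : BoundedInProbability P X) :
    BoundedInProbability P (fun n ω => ‖X n ω‖) :=
  hX.mono fun _ _ => (norm_norm _).le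

lemma boundedInProbability_of_tendstoInMeasure {X : ℕ → Ω → E}
    (hX : TendstoInMeasure P X atTop (fun _ => 0)) : BoundedInProbability P X := by
  rw [tendstoInMeasure_iff_norm] at hX
  intro ε hε
  refine ⟨1, ((ENNReal.tendsto_nhds_zero.1 (hX 1 one_pos)) ε hε).mono fun n hn => ?_⟩
  refine (measure_mono fun ω hω => ?_).trans hn
  simpa using le_of_lt (show 1 < ‖X n ω‖ from hω)

lemma tendstoInMeasure_zero_add {X Y : ℕ → Ω → E}
    (hX : TendstoInMeasure P X atTop (fun _ => 0)) (hY : TendstoInMeasure P Y atTop (fun _ => 0)) :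
    TendstoInMeasure P (fun n ω => X n ω + Y n ω) atTop (fun _ => 0) := by
  rw [tendstoInMeasure_iff_norm] at hX hY ⊢
  intro ε hε
  have h := (hX (ε / 2) (half_pos hε)).add (hY (ε / 2) (half_pos hε))
  rw [add_zero] at h
  refine tendsto_of_tendsto_of_tendsto_of_le_of_le tendsto_const_nhds h (fun _ => zero_le)
    fun n => (measure_mono fun ω hω => ?_).trans (measure_union_le _ _)
  simp only [Set.mem_ofPred_eq, Set.mem_union, sub_zero] at hω ⊢
  by_contra! hcon
  linarith [hcon.1, hcon.2, norm_add_le (X n ω) (Y n ω)]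

lemma tendstoInMeasure_zero_sum {κ : Type*} (s : Finset κ) {X : κ → ℕ → Ω → E}
    (hX : ∀ k ∈ s, TendstoInMeasure P (X k) atTop (fun _ => 0)) :
    TendstoInMeasure P (fun n ω => ∑ k ∈ s, X k n ω) atTop (fun _ => 0) := by
  classical
  induction s using Finset.induction_on with
  | empty =>
    rw [tendstoInMeasure_iff_norm]
    intro ε hε
    simp [not_le.2 hε]
  | insert k s hk ih =>
    simp only [Finset.sum_insert hk]
    exact tendstoInMeasure_zero_add (hX k (by simp)) (ih fun j hj => hX j (by simp [hj]))

lemma tendstoInMeasure_zero_norm {X : ℕ → Ω → E} (hX : TendstoInMeasure P X atTop (fun _ => 0)) :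
    TendstoInMeasure P (fun n ω => ‖X n ω‖) atTop (fun _ => 0) := by
  rw [tendstoInMeasure_iff_norm] at hX ⊢
  simpa using hX

lemma tendstoInMeasure_zero_clm [NormedSpace ℝ E] [NormedSpace ℝ F] {X : ℕ → Ω → E}
    (hX : TendstoInMeasure P X atTop (fun _ => 0)) (L : E →L[ℝ] F) :
    TendstoInMeasure P (fun n ω => L (X n ω)) atTop (fun _ => 0) := by
  rw [tendstoInMeasure_iff_norm] at hX ⊢
  intro ε hε
  refine tendsto_of_tendsto_of_tendsto_of_le_of_le tendsto_const_nhds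
    (hX (ε / (‖L‖ + 1)) (by positivity)) (fun _ => zero_le) fun n => measure_mono fun ω hω => ?_
  simp only [Set.mem_ofPred_eq, sub_zero] at hω ⊢
  rw [div_le_iff₀ (by positivity)]
  linarith [L.le_opNorm (X n ω), norm_nonneg (X n ω)]

/-- A sequence that converges in distribution is bounded in probability. -/
lemma boundedInProbability_of_tendstoInDistribution [MeasurableSpace E] [BorelSpace E]
    [IsProbabilityMeasure P] {Ω' : Type*} [MeasurableSpace Ω'] {P' : Measure Ω'}
    [IsProbabilityMeasure P'] {X : ℕ → Ω → E} {Z : Ω' → E}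
    (h : TendstoInDistribution X atTop Z (fun _ => P) P') : BoundedInProbability P X := by
  intro ε hε
  have hcl : ∀ M : ℝ, IsClosed {x : E | M ≤ ‖x‖} := fun M =>
    isClosed_le continuous_const continuous_norm
  have hlim : Tendsto (fun k : ℕ => (P'.map Z) {x : E | (k : ℝ) ≤ ‖x‖}) atTop (𝓝 0) := by
    have hP : IsProbabilityMeasure (P'.map Z) :=
      Measure.isProbabilityMeasure_map h.aemeasurable_limit
    have hi : (⋂ k : ℕ, {x : E | (k : ℝ) ≤ ‖x‖}) = ∅ := by
      ext x
      simp only [Set.mem_iInter, Set.mem_ofPred_eq, Set.mem_empty_iff_false, iff_false, not_forall,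
        not_le]
      exact exists_nat_gt ‖x‖
    rw [← measure_empty (μ := P'.map Z), ← hi]
    refine tendsto_measure_iInter_atTop (fun k => (hcl k).measurableSet.nullMeasurableSet) ?_
      ⟨0, measure_ne_top _ _⟩
    intro k l hkl x hx
    have : (k : ℝ) ≤ l := by exact_mod_cast hkl
    exact this.trans hx
  obtain ⟨k, hk⟩ := (hlim.eventually_lt_const hε).exists
  refine ⟨k, ?_⟩
  have hp := ProbabilityMeasure.limsup_measure_closed_le_of_tendsto h.tendsto (hcl k)
  have hlt := eventually_lt_of_limsup_lt (lt_of_le_of_lt hp hk)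
  filter_upwards [hlt] with n hn
  refine le_trans ?_ hn.le
  change _ ≤ (P.map (X n)) {x : E | (k : ℝ) ≤ ‖x‖}
  rw [Measure.map_apply_of_aemeasurable (h.forall_aemeasurable n) (hcl k).measurableSet]
  exact measure_mono fun ω (hω : (k : ℝ) < ‖X n ω‖) => show (k : ℝ) ≤ ‖X n ω‖ from hω.le

end Order

/-! ### Averages over the i.i.d. sample -/

section Sample

variable {Ω 𝒟 : Type*} [MeasurableSpace Ω] [MeasurableSpace 𝒟] {P : Measure Ω} {ν : Measure 𝒟}
  {D : ℕ → Ω → 𝒟}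

lemma ae_sample (hlaw : ∀ i, HasLaw (D i) ν P) {p : 𝒟 → Prop} (hp : ∀ᵐ d ∂ν, p d) :
    ∀ᵐ ω ∂P, ∀ i, p (D i ω) := by
  rw [ae_all_iff]
  intro i
  rw [← (hlaw i).map_eq] at hp
  exact ae_of_ae_map (hlaw i).aemeasurable hp

lemma aemeasurable_comp_sample (hlaw : ∀ i, HasLaw (D i) ν P) {E : Type*} [MeasurableSpace E]
    {φ : 𝒟 → E} (hφ : AEMeasurable φ ν) (i : ℕ) : AEMeasurable (fun ω => φ (D i ω)) P :=
  AEMeasurable.comp_aemeasurable (g := φ) (by rwa [(hlaw i).map_eq]) (hlaw i).aemeasurable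

lemma identDistrib_comp_sample (hlaw : ∀ i, HasLaw (D i) ν P) {E : Type*} [MeasurableSpace E]
    {φ : 𝒟 → E} (hφ : AEMeasurable φ ν) (i : ℕ) :
    IdentDistrib (fun ω => φ (D i ω)) (fun ω => φ (D 0 ω)) P P := by
  refine ⟨aemeasurable_comp_sample hlaw hφ i, aemeasurable_comp_sample hlaw hφ 0, ?_⟩
  have h : ∀ j, P.map (fun ω => φ (D j ω)) = ν.map φ := by
    intro j
    rw [← (hlaw j).map_eq, AEMeasurable.map_map_of_aemeasurable
      (by rwa [(hlaw j).map_eq]) (hlaw j).aemeasurable]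
    rfl
  rw [h, h]

lemma iIndepFun_comp_sample (hlaw : ∀ i, HasLaw (D i) ν P) (hindep : iIndepFun D P) {E : Type*}
    [MeasurableSpace E] {φ : 𝒟 → E} (hφ : AEMeasurable φ ν) :
    iIndepFun (fun i ω => φ (D i ω)) P :=
  hindep.comp₀ (fun _ => φ) (fun i => (hlaw i).aemeasurable)
    (fun i => by rwa [(hlaw i).map_eq])

/-- The weak law of large numbers. -/
lemma tendstoInMeasure_mean_sub [IsProbabilityMeasure P] (hlaw : ∀ i, HasLaw (D i) ν P)
    (hindep : iIndepFun D P) {φ : 𝒟 → ℝ} (hφ : Integrable φ ν) :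
    TendstoInMeasure P (fun (n : ℕ) ω => (n : ℝ)⁻¹ * ∑ i : Fin n, φ (D i ω) - ∫ d, φ d ∂ν)
      atTop (fun _ => 0) := by
  have hm := hφ.aemeasurable
  refine tendstoInMeasure_of_tendsto_ae (fun n => ?_) ?_
  · refine AEMeasurable.aestronglyMeasurable ?_
    refine ((Finset.aemeasurable_fun_sum _ fun i _ => ?_).const_mul _).sub_const _
    exact aemeasurable_comp_sample hlaw hm i
  · have hint : Integrable (fun ω => φ (D 0 ω)) P := by
      have := hφ
      rw [← (hlaw 0).map_eq] at this
      exact this.comp_aemeasurable (hlaw 0).aemeasurable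
    have hI : ∫ ω, φ (D 0 ω) ∂P = ∫ d, φ d ∂ν := (hlaw 0).integral_comp hφ.aestronglyMeasurable
    have := strong_law_ae_real (fun i ω => φ (D i ω)) hint
      (fun i j hij => (iIndepFun_comp_sample hlaw hindep hm).indepFun hij)
      (identDistrib_comp_sample hlaw hm)
    filter_upwards [this] with ω hω
    rw [hI] at hω
    have h2 := hω.sub_const (∫ d, φ d ∂ν)
    rw [sub_self] at h2
    refine h2.congr fun n => ?_
    rw [Finset.sum_range, div_eq_inv_mul]

lemma sqrt_mul_inv_natCast (n : ℕ) : Real.sqrt n * (n : ℝ)⁻¹ = (Real.sqrt n)⁻¹ := by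
  rw [← div_eq_mul_inv, Real.sqrt_div_self', one_div]

/-- The multivariate central limit theorem, reduced to the one-dimensional one through
characteristic functions. -/
lemma tendstoInDistribution_sqrt_smul_mean [IsProbabilityMeasure P]
    (hlaw : ∀ i, HasLaw (D i) ν P) (hindep : iIndepFun D P)
    {ι : Type*} [Fintype ι] [DecidableEq ι] {φ : 𝒟 → EuclideanSpace ℝ ι} (hφ : MemLp φ 2 ν)
    (h0 : ∫ d, φ d ∂ν = 0) {S : Matrix ι ι ℝ} (hS : S.PosSemidef)
    (hφS : ∀ i j, ∫ d, φ d i * φ d j ∂ν = S i j) :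
    TendstoInDistribution
      (fun (n : ℕ) ω => Real.sqrt n • ((n : ℝ)⁻¹ • ∑ i : Fin n, φ (D i ω))) atTop
      (fun z => Matrix.toEuclideanCLM (𝕜 := ℝ) (CFC.sqrt S) z) (fun _ => P)
      (stdGaussian (EuclideanSpace ℝ ι)) := by
  have hν : IsProbabilityMeasure ν := (hlaw 0).isProbabilityMeasure_iff.1 inferInstance
  have hm := hφ.aestronglyMeasurable.aemeasurable
  have hZm : ∀ n : ℕ, AEMeasurable
      (fun ω => Real.sqrt n • ((n : ℝ)⁻¹ • ∑ i : Fin n, φ (D i ω))) P := by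
    intro n
    have : AEMeasurable (fun ω => ∑ i : Fin n, φ (D i ω)) P :=
      Finset.aemeasurable_fun_sum _ fun i _ => aemeasurable_comp_sample hlaw hm i
    fun_prop
  refine ⟨hZm, by fun_prop, ProbabilityMeasure.tendsto_iff_tendsto_charFun.2 fun t => ?_⟩
  have hlim : charFun ((stdGaussian (EuclideanSpace ℝ ι)).map
      (fun z => Matrix.toEuclideanCLM (𝕜 := ℝ) (CFC.sqrt S) z)) t =
      Complex.exp (-(t.ofLp ⬝ᵥ S.mulVec t.ofLp : ℝ) / 2) := by
    have h := charFun_multivariateGaussian (μ := 0) hS t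
    simp only [multivariateGaussian, zero_add] at h
    rw [h]
    simp [neg_div]
  set v : ℝ := t.ofLp ⬝ᵥ S.mulVec t.ofLp with hv
  have hv0 : 0 ≤ v := by simpa using hS.dotProduct_mulVec_nonneg t.ofLp
  set X : ℕ → Ω → ℝ := fun i ω => inner ℝ (φ (D i ω)) t with hX
  have hψm : AEMeasurable (fun d => inner ℝ (φ d) t) ν := by fun_prop
  have hψ2 : MemLp (fun d => inner ℝ (φ d) t) 2 ν := by
    simpa only [real_inner_comm] using hφ.const_inner (𝕜 := ℝ) t
  have hX2 : MemLp (X 0) 2 P := by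
    have h := hψ2
    rw [← (hlaw 0).map_eq] at h
    exact h.comp_of_map (hlaw 0).aemeasurable
  have hmean : ∫ ω, X 0 ω ∂P = 0 := by
    have h1 : ∫ ω, X 0 ω ∂P = ∫ d, inner ℝ (φ d) t ∂ν :=
      (hlaw 0).integral_comp hψm.aestronglyMeasurable
    rw [h1]
    simp_rw [fun d => real_inner_comm t (φ d)]
    rw [integral_inner (hφ.integrable (by norm_num)), h0, inner_zero_right]
  have hcoord : ∀ i, MemLp (fun d => φ d i) 2 ν := fun i =>
    (EuclideanSpace.proj i : EuclideanSpace ℝ ι →L[ℝ] ℝ).comp_memLp' hφ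
  have hvar : Var[X 0; P] = v := by
    rw [variance_eq_integral hX2.aestronglyMeasurable.aemeasurable, hmean]
    have h1 : ∫ ω, (X 0 ω - 0) ^ 2 ∂P = ∫ d, (inner ℝ (φ d) t - 0) ^ 2 ∂ν :=
      (hlaw 0).integral_comp (f := fun d => (inner ℝ (φ d) t - 0) ^ 2)
        ((hψm.sub_const 0).pow_const 2).aestronglyMeasurable
    rw [h1]
    have h2 : ∀ d, (inner ℝ (φ d) t - 0) ^ 2 = ∑ i, ∑ j, t i * t j * (φ d i * φ d j) := by
      intro d
      simp only [sub_zero, PiLp.inner_apply, RCLike.inner_apply, conj_trivial, sq,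
        Finset.sum_mul_sum]
      exact Finset.sum_congr rfl fun i _ => Finset.sum_congr rfl fun j _ => by ring
    simp_rw [h2]
    have hint : ∀ i j, Integrable (fun d => t i * t j * (φ d i * φ d j)) ν := fun i j =>
      ((hcoord i).integrable_mul (hcoord j)).const_mul _
    rw [integral_finsetSum _ fun i _ => integrable_finsetSum _ fun j _ => hint i j]
    rw [hv]
    simp only [dotProduct, Matrix.mulVec, Finset.mul_sum]
    refine Finset.sum_congr rfl fun i _ => ?_
    rw [integral_finsetSum _ fun j _ => hint i j]
    refine Finset.sum_congr rfl fun j _ => ?_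
    rw [integral_const_mul, hφS]
    ring
  have hclt := tendstoInDistribution_inv_sqrt_mul_sum_sub (P := P)
    (P' := gaussianReal 0 Var[X 0; P].toNNReal) (Y := id) HasLaw.id hX2
    (iIndepFun_comp_sample hlaw hindep hψm) (identDistrib_comp_sample hlaw hψm)
  have hc := ProbabilityMeasure.tendsto_iff_tendsto_charFun.1 hclt.tendsto 1
  simp only [ProbabilityMeasure.coe_mk] at hc ⊢
  rw [Measure.map_id, charFun_gaussianReal, hvar] at hc
  rw [hlim]
  have he : Complex.exp ((1 : ℝ) * (0 : ℝ) * Complex.I - v.toNNReal * (1 : ℝ) ^ 2 / 2) =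
      Complex.exp (-(v : ℂ) / 2) := by
    have : ((v.toNNReal : ℝ) : ℂ) = v := by rw [Real.coe_toNNReal v hv0]
    congr 1
    rw [this]
    push_cast
    ring
  rw [he] at hc
  refine hc.congr fun n => ?_
  have hYm := hclt.forall_aemeasurable n
  rw [charFun_apply, charFun_apply, integral_map hYm (by fun_prop),
    integral_map (hZm n) (by fun_prop)]
  congr 1
  ext ω
  congr 2
  rw [hmean, mul_zero, sub_zero, smul_smul, sqrt_mul_inv_natCast, inner_smul_left, sum_inner,
    Finset.sum_range]
  simp [X]

end Sample

/-! ### Linearization of the estimating equations -/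

section Taylor

variable {𝒟 ι : Type*} [MeasurableSpace 𝒟] [Fintype ι] {p : ℕ} {ν : Measure 𝒟}
  {f : 𝒟 → EuclideanSpace ℝ (Fin p) → EuclideanSpace ℝ ι} {γ₀ : EuclideanSpace ℝ (Fin p)}

lemma norm_sub_sub_fderiv_le {E F : Type*} [NormedAddCommGroup E] [NormedSpace ℝ E]
    [NormedAddCommGroup F] [NormedSpace ℝ F] {f : E → F} {x₀ x : E} {r K : ℝ}
    (hf : ContDiffOn ℝ 2 f (Metric.ball x₀ r))
    (hK : ∀ y ∈ Metric.ball x₀ r, ‖iteratedFDeriv ℝ 2 f y‖ ≤ K) (hx : x ∈ Metric.ball x₀ r) :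
    ‖f x - f x₀ - fderiv ℝ f x₀ (x - x₀)‖ ≤ K * ‖x - x₀‖ ^ 2 := by
  have hr : 0 < r := Metric.pos_of_mem_ball hx
  have hat : ∀ y ∈ Metric.ball x₀ r, ContDiffAt ℝ 2 f y := fun y hy =>
    hf.contDiffAt (Metric.isOpen_ball.mem_nhds hy)
  have hx₀ : x₀ ∈ Metric.ball x₀ r := Metric.mem_ball_self hr
  have hK0 : 0 ≤ K := (norm_nonneg _).trans (hK x₀ hx₀)
  have hlip : ∀ y ∈ Metric.ball x₀ r, ‖fderiv ℝ f y - fderiv ℝ f x₀‖ ≤ K * ‖y - x₀‖ := by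
    intro y hy
    refine (convex_ball x₀ r).norm_image_sub_le_of_norm_fderiv_le (𝕜 := ℝ) (fun z hz => ?_)
      (fun z hz => ?_) hx₀ hy
    · exact ((hat z hz).fderiv_right (m := 1) (by norm_num)).differentiableAt (by norm_num)
    · have h := hK z hz
      rwa [show (2 : ℕ) = 1 + 1 from rfl, ← norm_iteratedFDeriv_fderiv,
        norm_iteratedFDeriv_one] at h
  have hsub : Metric.closedBall x₀ ‖x - x₀‖ ⊆ Metric.ball x₀ r := by
    refine Metric.closedBall_subset_ball ?_
    rwa [mem_ball_iff_norm] at hx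
  have := (convex_closedBall x₀ ‖x - x₀‖).norm_image_sub_le_of_norm_fderiv_le' (𝕜 := ℝ)
    (f := f) (φ := fderiv ℝ f x₀) (C := K * ‖x - x₀‖) (x := x₀) (y := x)
    (fun z hz => (hat z (hsub hz)).differentiableAt (by norm_num))
    (fun z hz => (hlip z (hsub hz)).trans (by
      rw [mem_closedBall_iff_norm] at hz
      gcongr))
    (by simp) (by rw [mem_closedBall_iff_norm])
  linarith [this]

/-- The consequences of the regularity condition used below: on a ball around `γ₀`, the estimating
functions are bounded and have a second order expansion, with an integrable envelope. -/
lemma Regular.exists_envelope (h : Regular ν f γ₀) : ∃ r > 0, ∃ K : 𝒟 → ℝ, Integrable K ν ∧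
    ∀ᵐ d ∂ν, 0 ≤ K d ∧ DifferentiableAt ℝ (f d) γ₀ ∧ ‖fderiv ℝ (f d) γ₀‖ ≤ K d ∧
      ∀ γ, ‖γ - γ₀‖ < r → ‖f d γ‖ ^ 3 ≤ K d ∧ ‖f d γ - f d γ₀‖ ≤ K d * ‖γ - γ₀‖ ∧
        ‖f d γ - f d γ₀ - fderiv ℝ (f d) γ₀ (γ - γ₀)‖ ≤ K d * ‖γ - γ₀‖ ^ 2 := by
  obtain ⟨U, hU, hγ, hC, K, hK, hb⟩ := h.smooth_bounded
  obtain ⟨r, hr, hball⟩ := Metric.isOpen_iff.1 hU γ₀ hγ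
  refine ⟨r, hr, K, hK, ?_⟩
  filter_upwards [hC, hb] with d h1 h2
  have hat : ∀ y ∈ U, DifferentiableAt ℝ (f d) y := fun y hy =>
    (h1.contDiffAt (hU.mem_nhds hy)).differentiableAt (by norm_num)
  refine ⟨(norm_nonneg _).trans (h2 γ₀ hγ).1, hat γ₀ hγ, (h2 γ₀ hγ).1, fun γ hγr => ?_⟩
  have hmem : γ ∈ Metric.ball γ₀ r := by rwa [mem_ball_iff_norm]
  refine ⟨(h2 γ (hball hmem)).2.2, ?_, ?_⟩
  · exact (convex_ball γ₀ r).norm_image_sub_le_of_norm_fderiv_le (𝕜 := ℝ)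
      (fun z hz => hat z (hball hz)) (fun z hz => (h2 z (hball hz)).1)
      (Metric.mem_ball_self hr) hmem
  · exact norm_sub_sub_fderiv_le (h1.mono hball) (fun y hy => (h2 y (hball hy)).2.1) hmem

/-- The derivative is measurable in the data as a limit of difference quotients. -/
lemma Regular.integrable_fderiv (h : Regular ν f γ₀)
    (hf : Measurable fun x : 𝒟 × EuclideanSpace ℝ (Fin p) => f x.1 x.2) (i : ι) (j : Fin p) :
    Integrable (fun d => fderiv ℝ (f d) γ₀ (EuclideanSpace.single j 1) i) ν := by
  obtain ⟨r, hr, K, hK, hb⟩ := h.exists_envelope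
  have hm : ∀ γ, Measurable fun d => f d γ := fun γ => hf.comp (measurable_id.prodMk measurable_const)
  refine hK.mono' (AEMeasurable.aestronglyMeasurable ?_) ?_
  · refine aemeasurable_of_tendsto_metrizable_ae atTop (f := fun (k : ℕ) d =>
      ((k : ℝ) • (f d (γ₀ + (k : ℝ)⁻¹ • EuclideanSpace.single j 1) - f d γ₀)) i)
      (fun k => ?_) ?_
    · have h1 := hm (γ₀ + (k : ℝ)⁻¹ • EuclideanSpace.single j 1)
      have h2 := hm γ₀
      fun_prop
    · filter_upwards [hb] with d hd
      have hl := (hd.2.1.hasFDerivAt.lim_real (EuclideanSpace.single j (1 : ℝ))).comp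
        (tendsto_natCast_atTop_atTop (R := ℝ))
      exact ((EuclideanSpace.proj i : EuclideanSpace ℝ ι →L[ℝ] ℝ).continuous.tendsto _).comp hl
  · filter_upwards [hb] with d hd
    refine (PiLp.norm_apply_le _ i).trans (((fderiv ℝ (f d) γ₀).le_opNorm _).trans ?_)
    simpa using hd.2.2.1

lemma norm_le_sum_abs (v : EuclideanSpace ℝ ι) : ‖v‖ ≤ ∑ k, |v k| := by
  classical
  have h : v = ∑ k, v k • EuclideanSpace.single k (1 : ℝ) := by
    ext j
    simp [Finset.sum_apply, Pi.single_apply]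
  calc ‖v‖ = ‖∑ k, v k • EuclideanSpace.single k (1 : ℝ)‖ := by rw [← h]
    _ ≤ ∑ k, ‖v k • EuclideanSpace.single k (1 : ℝ)‖ := norm_sum_le _ _
    _ = _ := by simp [norm_smul]

lemma norm_apply_le_sum_abs (L : EuclideanSpace ℝ (Fin p) →ₗ[ℝ] EuclideanSpace ℝ ι)
    (v : EuclideanSpace ℝ (Fin p)) :
    ‖L v‖ ≤ (∑ k, ∑ j, |L (EuclideanSpace.single j 1) k|) * ‖v‖ := by
  refine (norm_le_sum_abs _).trans ?_
  rw [Finset.sum_mul]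
  refine Finset.sum_le_sum fun k _ => ?_
  have h : v = ∑ j, v j • EuclideanSpace.single j (1 : ℝ) := by
    ext j
    simp [Finset.sum_apply, Pi.single_apply]
  have h2 : L v k = ∑ j, v j * L (EuclideanSpace.single j 1) k := by
    conv_lhs => rw [h, map_sum]
    simp
  rw [h2, Finset.sum_mul]
  refine (Finset.abs_sum_le_sum_abs _ _).trans (Finset.sum_le_sum fun j _ => ?_)
  rw [abs_mul, mul_comm]
  gcongr
  exact PiLp.norm_apply_le v j

end Taylor

/-- The normalized sum `n^{-1/2} ∑ᵢ f(Dᵢ, γ)`, written as `√n` times the sample mean, so that it is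
`0` for `n = 0`. -/
noncomputable def rootMean {Ω 𝒟 ι : Type*} {p : ℕ}
    (f : 𝒟 → EuclideanSpace ℝ (Fin p) → EuclideanSpace ℝ ι)
    (D : ℕ → Ω → 𝒟) (γ : EuclideanSpace ℝ (Fin p)) (n : ℕ) (ω : Ω) : EuclideanSpace ℝ ι :=
  Real.sqrt n • ((n : ℝ)⁻¹ • ∑ i : Fin n, f (D i ω) γ)

lemma tendsto_div_sqrt_natCast (c : ℝ) : Tendsto (fun n : ℕ => c / Real.sqrt n) atTop (𝓝 0) :=
  tendsto_const_nhds.div_atTop (Real.tendsto_sqrt_atTop.comp tendsto_natCast_atTop_atTop)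

section Expansion

variable {Ω 𝒟 ι : Type*} [MeasurableSpace Ω] [MeasurableSpace 𝒟] [Fintype ι] {p : ℕ}
  {P : Measure Ω} [IsProbabilityMeasure P] {ν : Measure 𝒟} {D : ℕ → Ω → 𝒟}
  {f : 𝒟 → EuclideanSpace ℝ (Fin p) → EuclideanSpace ℝ ι} {γ₀ : EuclideanSpace ℝ (Fin p)}
  {γhat : ℕ → Ω → EuclideanSpace ℝ (Fin p)}

/-- The first order expansion of the estimating equations at a root-n consistent estimator. -/
lemma tendstoInMeasure_rootMean_sub (hlaw : ∀ i, HasLaw (D i) ν P) (hindep : iIndepFun D P)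
    (hf : Measurable fun x : 𝒟 × EuclideanSpace ℝ (Fin p) => f x.1 x.2)
    (hreg : Regular ν f γ₀)
    (hb : BoundedInProbability P (fun n ω => Real.sqrt n • (γhat n ω - γ₀))) :
    TendstoInMeasure P (fun n ω => rootMean f D (γhat n ω) n ω - rootMean f D γ₀ n ω -
      Matrix.toEuclideanLin (meanJacobian ν f γ₀) (Real.sqrt n • (γhat n ω - γ₀)))
      atTop (fun _ => 0) := by
  obtain ⟨r, hr, K, hK, henv⟩ := hreg.exists_envelope
  set J := Matrix.toEuclideanLin (meanJacobian ν f γ₀) with hJ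
  set κ := ∫ d, K d ∂ν with hκ
  set kbar : ℕ → Ω → ℝ := fun n ω => (n : ℝ)⁻¹ * ∑ i : Fin n, K (D i ω) with hkbar
  set e : ι → Fin p → ℕ → Ω → ℝ := fun k j n ω => (n : ℝ)⁻¹ *
    ∑ i : Fin n, fderiv ℝ (f (D i ω)) γ₀ (EuclideanSpace.single j 1) k -
      ∫ d, fderiv ℝ (f d) γ₀ (EuclideanSpace.single j 1) k ∂ν with he
  have ha : TendstoInMeasure P (fun n ω => ‖kbar n ω - κ‖ + ∑ k, ∑ j, ‖e k j n ω‖)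
      atTop (fun _ => 0) := by
    have h1 : TendstoInMeasure P (fun n ω => kbar n ω - κ) atTop (fun _ => 0) :=
      tendstoInMeasure_mean_sub hlaw hindep hK
    have h2 : ∀ k j, TendstoInMeasure P (e k j) atTop (fun _ => 0) := fun k j =>
      tendstoInMeasure_mean_sub hlaw hindep
        (φ := fun d => fderiv ℝ (f d) γ₀ (EuclideanSpace.single j 1) k)
        (hreg.integrable_fderiv hf k j)
    have h3 : ∀ k, TendstoInMeasure P (fun n ω => ∑ j, ‖e k j n ω‖) atTop (fun _ => 0) := fun k =>
      tendstoInMeasure_zero_sum _ (X := fun j n ω => ‖e k j n ω‖)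
        fun j _ => tendstoInMeasure_zero_norm (h2 k j)
    exact tendstoInMeasure_zero_add (tendstoInMeasure_zero_norm h1)
      (tendstoInMeasure_zero_sum _ (X := fun k n ω => ∑ j, ‖e k j n ω‖) fun k _ => h3 k)
  refine tendstoInMeasure_zero_of_control (G := fun _ => Set.univ) ha hb.norm (by simp) ?_
  intro B ε hε
  have hκ0 : 0 ≤ κ := integral_nonneg_of_ae (henv.mono fun d hd => hd.1)
  refine ⟨min 1 (ε / (2 * (|B| + 1))), by positivity, ?_⟩
  filter_upwards [(tendsto_div_sqrt_natCast B).eventually_lt_const hr,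
    (tendsto_div_sqrt_natCast ((κ + 1) * B ^ 2)).eventually_lt_const (half_pos hε),
    eventually_gt_atTop 0] with n hn1 hn2 hn
  filter_upwards [ae_sample hlaw henv] with ω hω _ hA hB
  rw [abs_norm] at hB
  have hB0 : 0 ≤ B := (norm_nonneg _).trans hB
  have hs : 0 < Real.sqrt n := by positivity
  set δ := γhat n ω - γ₀ with hδ
  have hδB : ‖δ‖ * Real.sqrt n ≤ B := by
    rwa [norm_smul, Real.norm_of_nonneg hs.le, mul_comm] at hB
  have hδr : ‖δ‖ < r := lt_of_le_of_lt ((le_div_iff₀ hs).2 hδB) hn1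
  rw [abs_of_nonneg (by positivity), lt_min_iff] at hA
  have hsum0 : 0 ≤ ∑ k, ∑ j, ‖e k j n ω‖ := by positivity
  have hk1 : kbar n ω ≤ κ + 1 := by
    have := le_abs_self (kbar n ω - κ)
    rw [← Real.norm_eq_abs] at this
    linarith
  have he1 : (∑ k, ∑ j, ‖e k j n ω‖) * (|B| + 1) < ε / 2 := by
    have h1 : ∑ k, ∑ j, ‖e k j n ω‖ < ε / (2 * (|B| + 1)) := by
      linarith [norm_nonneg (kbar n ω - κ)]
    rw [lt_div_iff₀ (by positivity)] at h1
    linarith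
  -- the averaged derivative and the averaged second order remainder
  set Jn : EuclideanSpace ℝ (Fin p) →ₗ[ℝ] EuclideanSpace ℝ ι :=
    (n : ℝ)⁻¹ • ∑ i : Fin n, (fderiv ℝ (f (D i ω)) γ₀ : EuclideanSpace ℝ (Fin p) →ₗ[ℝ] _) with hJn
  set R : EuclideanSpace ℝ ι := (n : ℝ)⁻¹ • ∑ i : Fin n,
    (f (D i ω) (γhat n ω) - f (D i ω) γ₀ - fderiv ℝ (f (D i ω)) γ₀ δ) with hR
  have hdec : rootMean f D (γhat n ω) n ω - rootMean f D γ₀ n ω - J (Real.sqrt n • δ) =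
      (Jn - J) (Real.sqrt n • δ) + Real.sqrt n • R := by
    simp only [rootMean, hR, hJn, LinearMap.sub_apply, LinearMap.smul_apply, LinearMap.sum_apply,
      map_smul, Finset.sum_sub_distrib, smul_sub, ContinuousLinearMap.coe_coe]
    abel
  have hRle : ‖R‖ ≤ kbar n ω * ‖δ‖ ^ 2 := by
    rw [hR, norm_smul, norm_inv, Real.norm_natCast, hkbar, mul_assoc, Finset.sum_mul]
    gcongr
    refine (norm_sum_le _ _).trans (Finset.sum_le_sum fun i _ => ?_)
    exact ((hω i).2.2.2 _ hδr).2.2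
  have hJle : ‖(Jn - J) (Real.sqrt n • δ)‖ ≤ (∑ k, ∑ j, ‖e k j n ω‖) * B := by
    refine (norm_apply_le_sum_abs _ _).trans ?_
    have : ∀ k j, |(Jn - J) (EuclideanSpace.single j 1) k| = ‖e k j n ω‖ := by
      intro k j
      rw [Real.norm_eq_abs]
      congr 1
      simp [he, hJn, hJ, meanJacobian]
    simp_rw [this]
    gcongr
  rw [hdec]
  have h2 : ‖Real.sqrt n • R‖ ≤ (κ + 1) * B ^ 2 / Real.sqrt n := by
    rw [norm_smul, Real.norm_of_nonneg hs.le, le_div_iff₀ hs]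
    calc Real.sqrt n * ‖R‖ * Real.sqrt n
        ≤ Real.sqrt n * (kbar n ω * ‖δ‖ ^ 2) * Real.sqrt n := by gcongr
      _ = kbar n ω * (‖δ‖ * Real.sqrt n) ^ 2 := by ring
      _ ≤ (κ + 1) * B ^ 2 := by gcongr
  have h3 : (∑ k, ∑ j, ‖e k j n ω‖) * B ≤ (∑ k, ∑ j, ‖e k j n ω‖) * (|B| + 1) := by
    gcongr
    linarith [le_abs_self B]
  linarith [norm_add_le ((Jn - J) (Real.sqrt n • δ)) (Real.sqrt n • R)]

end Expansion

/-! ### The quadratic approximation of the log empirical likelihood ratio -/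

section PosDef

variable {ι : Type*} [Fintype ι] [DecidableEq ι] {S : Matrix ι ι ℝ}

lemma inner_toEuclideanLin (S : Matrix ι ι ℝ) (v w : EuclideanSpace ℝ ι) :
    inner ℝ v (Matrix.toEuclideanLin S w) = ∑ k, ∑ l, v k * w l * S k l := by
  simp only [PiLp.inner_apply, RCLike.inner_apply, conj_trivial, Matrix.toLpLin_apply,
    Matrix.mulVec, dotProduct, Finset.sum_mul]
  exact Finset.sum_congr rfl fun k _ => Finset.sum_congr rfl fun l _ => by ring

lemma exists_mul_norm_sq_le_inner (hS : S.PosDef) :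
    ∃ c > 0, ∀ v, c * ‖v‖ ^ 2 ≤ inner ℝ v (Matrix.toEuclideanLin S v) := by
  have hpos : ∀ v : EuclideanSpace ℝ ι, v ≠ 0 → 0 < inner ℝ v (Matrix.toEuclideanLin S v) := by
    intro v hv
    have h := hS.dotProduct_mulVec_pos (x := v.ofLp) (by simpa using hv)
    rw [inner_toEuclideanLin]
    simp only [dotProduct, Matrix.mulVec, Finset.mul_sum, star_trivial] at h
    refine h.trans_le (le_of_eq ?_)
    exact Finset.sum_congr rfl fun k _ => Finset.sum_congr rfl fun l _ => by ring
  set q : EuclideanSpace ℝ ι → ℝ := fun v => inner ℝ v (Matrix.toEuclideanLin S v) with hq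
  have hcont : Continuous q :=
    continuous_id.inner (Matrix.toEuclideanLin S).continuous_of_finiteDimensional
  rcases (Metric.sphere (0 : EuclideanSpace ℝ ι) 1).eq_empty_or_nonempty with he | hne
  · refine ⟨1, one_pos, fun v => ?_⟩
    have hv : v = 0 := by
      by_contra hv
      have : ‖v‖⁻¹ • v ∈ Metric.sphere (0 : EuclideanSpace ℝ ι) 1 := by
        simp [norm_smul, hv]
      rw [he] at this
      exact this
    simp [hv]
  · obtain ⟨u, hu, hmin⟩ := (isCompact_sphere (0 : EuclideanSpace ℝ ι) 1).exists_isMinOn hne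
      hcont.continuousOn
    have hu0 : u ≠ 0 := by
      rintro rfl
      simp at hu
    refine ⟨q u, hpos u hu0, fun v => ?_⟩
    by_cases hv : v = 0
    · simp [hv]
    have hv0 : 0 < ‖v‖ := norm_pos_iff.2 hv
    have h1 : q u ≤ q (‖v‖⁻¹ • v) := hmin (by simp [norm_smul, hv])
    have h2 : q (‖v‖⁻¹ • v) = (‖v‖ ^ 2)⁻¹ * q v := by
      simp only [hq, map_smul, inner_smul_left, inner_smul_right, conj_trivial]
      rw [← mul_assoc]; congr 1; field_simp
    rw [h2, ← div_eq_inv_mul, le_div_iff₀ (by positivity)] at h1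
    exact h1

lemma isSymmetric_toEuclideanLin (hS : S.PosDef) : (Matrix.toEuclideanLin S).IsSymmetric :=
  Matrix.isSymmetric_toEuclideanLin_iff.2 hS.isHermitian

lemma exists_inner_le_mul_norm_sq (S : Matrix ι ι ℝ) :
    ∃ C, 0 ≤ C ∧ ∀ v, inner ℝ v (Matrix.toEuclideanLin S v) ≤ C * ‖v‖ ^ 2 := by
  refine ⟨‖(Matrix.toEuclideanLin S).toContinuousLinearMap‖, norm_nonneg _, fun v => ?_⟩
  have h := (Matrix.toEuclideanLin S).toContinuousLinearMap.le_opNorm v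
  refine (real_inner_le_norm _ _).trans ?_
  calc ‖v‖ * ‖Matrix.toEuclideanLin S v‖ ≤ ‖v‖ * (_ * ‖v‖) := by gcongr; exact h
    _ = _ := by ring

lemma toEuclideanLin_inv_apply (hS : S.PosDef) (v : EuclideanSpace ℝ ι) :
    Matrix.toEuclideanLin S (Matrix.toEuclideanLin S⁻¹ v) = v := by
  have := hS.isUnit.map (Matrix.detMonoidHom)
  rw [Matrix.toLpLin_apply, Matrix.toLpLin_apply]
  simp only [Matrix.mulVec_mulVec]
  rw [Matrix.mul_nonsing_inv _ this, Matrix.one_mulVec]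

/-- The quadratic form of the second moments of a sample is close to that of `S` if the entries of
the matrices are close. -/
lemma abs_sum_inner_sq_sub_le {n : ℕ} (hn : 0 < n) (y : Fin n → EuclideanSpace ℝ ι)
    (v : EuclideanSpace ℝ ι) :
    |∑ i, inner ℝ v (y i) ^ 2 - n * inner ℝ v (Matrix.toEuclideanLin S v)| ≤
      n * ((∑ k, ∑ l, |(n : ℝ)⁻¹ * ∑ i, y i k * y i l - S k l|) * ‖v‖ ^ 2) := by
  have hn' : (n : ℝ) ≠ 0 := by positivity
  have h : ∑ i, inner ℝ v (y i) ^ 2 - n * inner ℝ v (Matrix.toEuclideanLin S v) =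
      n * ∑ k, ∑ l, v k * v l * ((n : ℝ)⁻¹ * ∑ i, y i k * y i l - S k l) := by
    have h1 : ∀ i, inner ℝ v (y i) ^ 2 = ∑ k, ∑ l, v k * v l * (y i k * y i l) := by
      intro i
      simp only [PiLp.inner_apply, RCLike.inner_apply, conj_trivial, sq, Finset.sum_mul_sum]
      exact Finset.sum_congr rfl fun k _ => Finset.sum_congr rfl fun l _ => by ring
    have h2 : ∑ i, inner ℝ v (y i) ^ 2 = ∑ k, ∑ l, v k * v l * ∑ i, y i k * y i l := by
      simp_rw [h1]
      rw [Finset.sum_comm]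
      refine Finset.sum_congr rfl fun k _ => ?_
      rw [Finset.sum_comm]
      simp_rw [Finset.mul_sum]
    rw [h2, inner_toEuclideanLin, Finset.mul_sum, Finset.mul_sum, ← Finset.sum_sub_distrib]
    refine Finset.sum_congr rfl fun k _ => ?_
    rw [Finset.mul_sum, Finset.mul_sum, ← Finset.sum_sub_distrib]
    refine Finset.sum_congr rfl fun l _ => ?_
    field_simp
  rw [h, abs_mul, Nat.abs_cast, Finset.sum_mul]
  gcongr
  refine (Finset.abs_sum_le_sum_abs _ _).trans (Finset.sum_le_sum fun k _ => ?_)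
  rw [Finset.sum_mul]
  refine (Finset.abs_sum_le_sum_abs _ _).trans (Finset.sum_le_sum fun l _ => ?_)
  rw [abs_mul, abs_mul, mul_comm, sq]
  gcongr
  · exact PiLp.norm_apply_le v k
  · exact PiLp.norm_apply_le v l

end PosDef

/-- The bound on the estimating functions that an integrable bound on their third powers gives for
a sample of size `n` is of smaller order than `√n`. -/
lemma tendsto_one_add_rpow_div_sqrt {κ : ℝ} (hκ : 0 ≤ κ) :
    Tendsto (fun n : ℕ => (1 + ((n : ℝ) * κ) ^ (1 / 3 : ℝ)) / Real.sqrt n) atTop (𝓝 0) := by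
  have h1 := tendsto_div_sqrt_natCast 1
  have h2 : Tendsto (fun n : ℕ => κ ^ (1 / 3 : ℝ) * (n : ℝ) ^ (-(1 / 6) : ℝ)) atTop (𝓝 0) := by
    have := ((tendsto_rpow_neg_atTop (show (0 : ℝ) < 1 / 6 by norm_num)).comp
      (tendsto_natCast_atTop_atTop (R := ℝ))).const_mul (κ ^ (1 / 3 : ℝ))
    simpa using this
  have h3 := h1.add h2
  rw [add_zero] at h3
  refine h3.congr' ?_
  filter_upwards [eventually_gt_atTop 0] with n hn
  have hn' : (0 : ℝ) < n := by positivity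
  rw [add_div, Real.mul_rpow hn'.le hκ, Real.sqrt_eq_rpow, mul_comm ((n : ℝ) ^ (1 / 3 : ℝ)),
    mul_div_assoc, ← Real.rpow_sub hn']
  norm_num

section Regular

variable {Ω 𝒟 ι : Type*} [MeasurableSpace Ω] [MeasurableSpace 𝒟] [Fintype ι] {p : ℕ}
  {P : Measure Ω} [IsProbabilityMeasure P] {ν : Measure 𝒟} {D : ℕ → Ω → 𝒟}
  {f : 𝒟 → EuclideanSpace ℝ (Fin p) → EuclideanSpace ℝ ι} {γ₀ : EuclideanSpace ℝ (Fin p)}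
  {γhat : ℕ → Ω → EuclideanSpace ℝ (Fin p)}

lemma Regular.memLp_two [IsFiniteMeasure ν] (h : Regular ν f γ₀)
    (hf : Measurable fun x : 𝒟 × EuclideanSpace ℝ (Fin p) => f x.1 x.2) :
    MemLp (fun d => f d γ₀) 2 ν := by
  have hm : Measurable fun d => f d γ₀ := hf.comp (measurable_id.prodMk measurable_const)
  obtain ⟨r, hr, K, hK, henv⟩ := h.exists_envelope
  rw [memLp_two_iff_integrable_sq_norm hm.aestronglyMeasurable]
  refine ((integrable_const (1 : ℝ)).add hK).mono'
    (hm.norm.pow_const 2).aestronglyMeasurable ?_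
  filter_upwards [henv] with d hd
  have h3 := (hd.2.2.2 γ₀ (by simpa using hr)).1
  rw [Real.norm_of_nonneg (by positivity), Pi.add_apply]
  set t := ‖f d γ₀‖
  have ht : 0 ≤ t := norm_nonneg _
  nlinarith [mul_nonneg (add_nonneg ht zero_le_one) (sq_nonneg (t - 1)), sq_nonneg (t - 1)]

lemma Regular.integrable_mul [IsFiniteMeasure ν] (h : Regular ν f γ₀)
    (hf : Measurable fun x : 𝒟 × EuclideanSpace ℝ (Fin p) => f x.1 x.2) (k l : ι) :
    Integrable (fun d => f d γ₀ k * f d γ₀ l) ν := by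
  have hc : ∀ k, MemLp (fun d => f d γ₀ k) 2 ν := fun k =>
    (EuclideanSpace.proj k : EuclideanSpace ℝ ι →L[ℝ] ℝ).comp_memLp' (h.memLp_two hf)
  exact (hc k).integrable_mul (hc l)

/-- Twice the negative log empirical likelihood ratio at a root-n consistent estimator is the
quadratic form of the inverse second moment matrix at `√n` times the mean, up to `o_p(1)`. -/
lemma tendstoInMeasure_two_mul_negLogEL_sub [DecidableEq ι]
    (hlaw : ∀ i, HasLaw (D i) ν P) (hindep : iIndepFun D P)
    (hf : Measurable fun x : 𝒟 × EuclideanSpace ℝ (Fin p) => f x.1 x.2)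
    (hreg : Regular ν f γ₀)
    (hb : BoundedInProbability P (fun n ω => Real.sqrt n • (γhat n ω - γ₀)))
    (hu : BoundedInProbability P (fun n ω => rootMean f D (γhat n ω) n ω))
    {lamhat : ℕ → Ω → EuclideanSpace ℝ ι}
    (hlam : ∀ n, ∀ᵐ ω ∂P, (∃ lam, IsMultiplier (fun i : Fin n => f (D i ω) (γhat n ω)) lam) →
      IsMultiplier (fun i : Fin n => f (D i ω) (γhat n ω)) (lamhat n ω)) :
    TendstoInMeasure P (fun n ω =>
      2 * negLogEL (fun i : Fin n => f (D i ω) (γhat n ω)) (lamhat n ω) -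
        inner ℝ (Matrix.toEuclideanLin (secondMoment ν f γ₀)⁻¹ (rootMean f D (γhat n ω) n ω))
          (rootMean f D (γhat n ω) n ω)) atTop (fun _ => 0) := by
  have hν : IsProbabilityMeasure ν := (hlaw 0).isProbabilityMeasure_iff.1 inferInstance
  obtain ⟨r, hr, K, hK, henv⟩ := hreg.exists_envelope
  set S := secondMoment ν f γ₀ with hS
  obtain ⟨c, hc, hTc⟩ := exists_mul_norm_sq_le_inner hreg.posDef
  obtain ⟨C, hC, hTC⟩ := exists_inner_le_mul_norm_sq S
  set κ := ∫ d, K d ∂ν with hκ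
  have hκ0 : 0 ≤ κ := integral_nonneg_of_ae (henv.mono fun d hd => hd.1)
  set kbar : ℕ → Ω → ℝ := fun n ω => (n : ℝ)⁻¹ * ∑ i : Fin n, K (D i ω) with hkbar
  set e : ι → ι → ℕ → Ω → ℝ := fun k l n ω => (n : ℝ)⁻¹ *
    ∑ i : Fin n, f (D i ω) γ₀ k * f (D i ω) γ₀ l - S k l with he
  have ha : TendstoInMeasure P (fun n ω => ‖kbar n ω - κ‖ + ∑ k, ∑ l, ‖e k l n ω‖)
      atTop (fun _ => 0) := by
    have h1 : TendstoInMeasure P (fun n ω => kbar n ω - κ) atTop (fun _ => 0) :=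
      tendstoInMeasure_mean_sub hlaw hindep hK
    have h2 : ∀ k l, TendstoInMeasure P (e k l) atTop (fun _ => 0) := fun k l =>
      tendstoInMeasure_mean_sub hlaw hindep
        (φ := fun d => f d γ₀ k * f d γ₀ l) (hreg.integrable_mul hf k l)
    have h3 : ∀ k, TendstoInMeasure P (fun n ω => ∑ l, ‖e k l n ω‖) atTop (fun _ => 0) := fun k =>
      tendstoInMeasure_zero_sum _ (X := fun l n ω => ‖e k l n ω‖)
        fun l _ => tendstoInMeasure_zero_norm (h2 k l)
    exact tendstoInMeasure_zero_add (tendstoInMeasure_zero_norm h1)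
      (tendstoInMeasure_zero_sum _ (X := fun k n ω => ∑ l, ‖e k l n ω‖) fun k _ => h3 k)
  refine tendstoInMeasure_zero_of_control (G := fun _ => Set.univ) ha (hb.norm_add_norm hu)
    (by simp) ?_
  intro B₀ ε hε
  set B := |B₀| + 1 with hBdef
  have hB0 : 0 < B := by positivity
  -- `ρ / √n` bounds the multiplier.
  set ρ := 4 * B / c with hρ
  have hρ0 : 0 < ρ := by positivity
  set η := min (c / 2) (ε / (4 * ρ ^ 2)) with hη
  have hη0 : 0 < η := by positivity
  have hηρ : η * ρ ^ 2 ≤ ε / 4 := by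
    have h := min_le_right (c / 2) (ε / (4 * ρ ^ 2))
    rw [← hη, le_div_iff₀ (by positivity)] at h
    linarith
  -- `∑ᵢ K(Dᵢ) ≤ n (κ + 1)` with high probability, so `M n` bounds the estimating functions of the
  -- whole sample.
  set M : ℕ → ℝ := fun n => 1 + ((n : ℝ) * (κ + 1)) ^ (1 / 3 : ℝ) with hM
  have hs : Tendsto (fun n : ℕ => M n / Real.sqrt n) atTop (𝓝 0) :=
    tendsto_one_add_rpow_div_sqrt (by positivity)
  have hsmul : ∀ (a b : ℝ), 0 < b → ∀ᶠ n : ℕ in atTop, a * (M n / Real.sqrt n) < b := by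
    intro a b hb
    have h := hs.const_mul a
    rw [mul_zero] at h
    exact h.eventually_lt_const hb
  refine ⟨min 1 (η / 2), by positivity, ?_⟩
  filter_upwards [(tendsto_div_sqrt_natCast B).eventually_lt_const hr,
    hsmul (2 * (κ + 1) * B) (η / 2) (by positivity), hsmul (64 * B) c hc,
    hsmul (4 * (C + η) * ρ ^ 3) (ε / 2) (by positivity), eventually_gt_atTop 0]
    with n hn1 hn2 hn3 hn4 hn
  filter_upwards [ae_sample hlaw henv, hlam n] with ω hω hlamω _ hA hB
  have hn' : (0 : ℝ) < n := by positivity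
  have hs0 : 0 < Real.sqrt n := by positivity
  have hss : Real.sqrt n * Real.sqrt n = n := Real.mul_self_sqrt hn'.le
  have hMn : 0 < M n := by positivity
  set u := rootMean f D (γhat n ω) n ω
  set δ := γhat n ω - γ₀ with hδ
  rw [abs_of_nonneg (by positivity)] at hB
  have hBB : B₀ ≤ B := (le_abs_self _).trans (by linarith)
  have huB : ‖u‖ ≤ B := by linarith [norm_nonneg (Real.sqrt n • δ)]
  have hδB : ‖δ‖ * Real.sqrt n ≤ B := by
    have : ‖Real.sqrt n • δ‖ ≤ B := by linarith [norm_nonneg u]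
    rwa [norm_smul, Real.norm_of_nonneg hs0.le, mul_comm] at this
  have hδ' : ‖δ‖ ≤ B / Real.sqrt n := (le_div_iff₀ hs0).2 hδB
  have hδr : ‖δ‖ < r := lt_of_le_of_lt hδ' hn1
  rw [abs_of_nonneg (by positivity), lt_min_iff] at hA
  have hsum0 : 0 ≤ ∑ k, ∑ l, ‖e k l n ω‖ := by positivity
  have hk1 : kbar n ω ≤ κ + 1 := by
    have := le_abs_self (kbar n ω - κ)
    rw [← Real.norm_eq_abs] at this
    linarith
  have he1 : ∑ k, ∑ l, ‖e k l n ω‖ < η / 2 := by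
    linarith [norm_nonneg (kbar n ω - κ)]
  have hKsum : ∑ i : Fin n, K (D i ω) ≤ n * (κ + 1) := by
    rw [hkbar] at hk1
    rwa [inv_mul_le_iff₀ hn'] at hk1
  have hbound : ∀ γ, ‖γ - γ₀‖ < r → ∀ i : Fin n, ‖f (D i ω) γ‖ ≤ M n := by
    intro γ hγ i
    have h1 : ‖f (D i ω) γ‖ ^ 3 ≤ n * (κ + 1) :=
      (((hω i).2.2.2 γ hγ).1.trans (Finset.single_le_sum (f := fun i : Fin n => K (D i ω))
        (fun j _ => (hω j).1) (Finset.mem_univ i))).trans hKsum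
    have h2 : ‖f (D i ω) γ‖ = (‖f (D i ω) γ‖ ^ 3) ^ (1 / 3 : ℝ) := by
      rw [← Real.rpow_natCast, ← Real.rpow_mul (norm_nonneg _)]
      norm_num
    rw [h2, hM]
    have : (‖f (D i ω) γ‖ ^ 3) ^ (1 / 3 : ℝ) ≤ ((n : ℝ) * (κ + 1)) ^ (1 / 3 : ℝ) := by gcongr
    linarith
  set x : Fin n → EuclideanSpace ℝ ι := fun i => f (D i ω) (γhat n ω) with hx
  set y : Fin n → EuclideanSpace ℝ ι := fun i => f (D i ω) γ₀ with hy
  have hxM : ∀ i, ‖x i‖ ≤ M n := hbound _ hδr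
  have hyM : ∀ i, ‖y i‖ ≤ M n := hbound _ (by simpa using hr)
  have hTη : ∀ v : EuclideanSpace ℝ ι,
      |∑ i, inner ℝ v (x i) ^ 2 - n * inner ℝ v (Matrix.toEuclideanLin S v)| ≤
        n * (η * ‖v‖ ^ 2) := by
    intro v
    have h1 := abs_sum_inner_sq_sub_le (S := S) hn y v
    -- Only one factor of `inner v (x i - y i) * inner v (x i + y i)` is bounded by the envelope `K`,
    -- the other by `M n`: the product of the two envelopes, `K ^ (4 / 3)`, need not be integrable.
    have h2 : |∑ i, inner ℝ v (x i) ^ 2 - ∑ i, inner ℝ v (y i) ^ 2| ≤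
        n * (η / 2 * ‖v‖ ^ 2) := by
      rw [← Finset.sum_sub_distrib]
      refine (Finset.abs_sum_le_sum_abs _ _).trans ?_
      have h3 : ∀ i, |inner ℝ v (x i) ^ 2 - inner ℝ v (y i) ^ 2| ≤
          K (D i ω) * (‖δ‖ * (2 * M n) * ‖v‖ ^ 2) := by
        intro i
        have h4 : inner ℝ v (x i) ^ 2 - inner ℝ v (y i) ^ 2 =
            inner ℝ v (x i - y i) * inner ℝ v (x i + y i) := by
          rw [inner_sub_right, inner_add_right]; ring
        have h5 : ‖x i - y i‖ ≤ K (D i ω) * ‖δ‖ := ((hω i).2.2.2 _ hδr).2.1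
        have h6 : ‖x i + y i‖ ≤ 2 * M n :=
          (norm_add_le _ _).trans (by linarith [hxM i, hyM i])
        rw [h4, abs_mul]
        calc |inner ℝ v (x i - y i)| * |inner ℝ v (x i + y i)|
            ≤ (‖v‖ * ‖x i - y i‖) * (‖v‖ * ‖x i + y i‖) :=
              mul_le_mul (abs_real_inner_le_norm _ _) (abs_real_inner_le_norm _ _)
                (abs_nonneg _) (by positivity)
          _ ≤ (‖v‖ * (K (D i ω) * ‖δ‖)) * (‖v‖ * (2 * M n)) := by
              have := (norm_nonneg _).trans h5
              gcongr
          _ = _ := by ring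
      refine (Finset.sum_le_sum fun i _ => h3 i).trans ?_
      rw [← Finset.sum_mul]
      calc (∑ i : Fin n, K (D i ω)) * (‖δ‖ * (2 * M n) * ‖v‖ ^ 2)
          ≤ (n * (κ + 1)) * (B / Real.sqrt n * (2 * M n) * ‖v‖ ^ 2) := by gcongr
        _ = n * ((2 * (κ + 1) * B * (M n / Real.sqrt n)) * ‖v‖ ^ 2) := by ring
        _ ≤ n * (η / 2 * ‖v‖ ^ 2) := by gcongr
    have h3 : n * ((∑ k, ∑ l, |(n : ℝ)⁻¹ * ∑ i, y i k * y i l - S k l|) * ‖v‖ ^ 2) ≤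
        n * (η / 2 * ‖v‖ ^ 2) := by
      gcongr
      exact he1.le
    have h4 := abs_sub_le (∑ i, inner ℝ v (x i) ^ 2) (∑ i, inner ℝ v (y i) ^ 2)
      (n * inner ℝ v (Matrix.toEuclideanLin S v))
    linarith
  set m := (n : ℝ)⁻¹ • ∑ i, x i with hmdef
  have hum : u = Real.sqrt n • m := rfl
  have hmu : ‖m‖ = ‖u‖ / Real.sqrt n := by
    have : ‖u‖ = Real.sqrt n * ‖m‖ := by
      rw [hum, norm_smul (Real.sqrt n) m, Real.norm_of_nonneg hs0.le]
    rw [this]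
    field_simp
  have hmB : 64 * M n * ‖m‖ < c := by
    refine lt_of_le_of_lt ?_ hn3
    rw [hmu]
    calc 64 * M n * (‖u‖ / Real.sqrt n) ≤ 64 * M n * (B / Real.sqrt n) := by gcongr
      _ = _ := by ring
  have hηc : η ≤ c / 2 := min_le_left _ _
  have hmult := hlamω (exists_isMultiplier hn hMn hxM
    (mul_norm_sq_le_sum_inner_sq hηc hTc hTη) hmB)
  have hmain := hmult.abs_two_mul_negLogEL_sub_le (w := Matrix.toEuclideanLin S⁻¹ m) hn hMn hxM hc
    hη0.le hηc hC (isSymmetric_toEuclideanLin hreg.posDef) hTc hTC hTη hmB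
    (toEuclideanLin_inv_apply hreg.posDef m)
  rw [← hmdef] at hmain
  have hq : inner ℝ (Matrix.toEuclideanLin S⁻¹ u) u =
      n * inner ℝ (Matrix.toEuclideanLin S⁻¹ m) m := by
    rw [hum, map_smul, inner_smul_left, inner_smul_right, ← mul_assoc, conj_trivial, hss]
  rw [hq, Real.norm_eq_abs]
  refine lt_of_le_of_lt hmain ?_
  have h7 : 4 * ‖m‖ / c ≤ ρ / Real.sqrt n := by
    calc 4 * ‖m‖ / c ≤ 4 * (B / Real.sqrt n) / c := by rw [hmu]; gcongr
      _ = ρ / Real.sqrt n := by rw [hρ]; ring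
  calc n * (η * (4 * ‖m‖ / c) ^ 2 + 4 * M n * (C + η) * (4 * ‖m‖ / c) ^ 3)
      ≤ n * (η * (ρ / Real.sqrt n) ^ 2 + 4 * M n * (C + η) * (ρ / Real.sqrt n) ^ 3) := by
        gcongr
    _ = η * ρ ^ 2 + (4 * (C + η) * ρ ^ 3) * (M n / Real.sqrt n) := by
        generalize Real.sqrt n = s at hss hs0 ⊢
        rw [← hss]
        field_simp
    _ < ε := by linarith

end Regular

/-! ### Quadratic forms of a standard Gaussian vector -/

/-- Selecting coordinates of a vector of independent standard Gaussian variables and squaring them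
gives independent `χ²₁` variables. -/
lemma map_pi_gaussianReal_sq {ι κ : Type*} [Fintype ι] [Fintype κ] {φ : κ → ι}
    (hφ : Function.Injective φ) :
    (Measure.pi fun _ : ι => gaussianReal 0 1).map (fun x k => x (φ k) ^ 2) =
      Measure.pi fun _ : κ => chiSqOne := by
  have hind : iIndepFun (fun i (x : ι → ℝ) => x i) (Measure.pi fun _ : ι => gaussianReal 0 1) :=
    iIndepFun_pi (X := fun _ x => x) fun _ => aemeasurable_id
  have hind' : iIndepFun (fun k (x : ι → ℝ) => x (φ k) ^ 2)
      (Measure.pi fun _ : ι => gaussianReal 0 1) :=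
    (hind.precomp hφ).comp (fun _ (y : ℝ) => y ^ 2) fun _ => by fun_prop
  rw [(iIndepFun_iff_map_fun_eq_pi_map fun k =>
    ((measurable_pi_apply (φ k)).pow_const 2).aemeasurable).1 hind']
  congr 1
  ext1 k
  have h := (measurePreserving_eval (fun _ : ι => gaussianReal 0 1) (φ k)).map_eq
  conv_rhs => rw [chiSqOne, ← h, Measure.map_map (by fun_prop) (by fun_prop)]
  rfl

/-- A quadratic form of a standard Gaussian vector is distributed as a combination of independent
`χ²₁` variables, with the non-zero eigenvalues as coefficients. -/
lemma exists_map_stdGaussian_inner_eq {ι : Type*} [Fintype ι] [DecidableEq ι] {A : Matrix ι ι ℝ}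
    (hA : A.IsHermitian) : ∃ Λ : Fin A.rank → ℝ,
      Finset.univ.val.map Λ = A.charpoly.roots.filter (fun x => x ≠ 0) ∧
      (stdGaussian (EuclideanSpace ℝ ι)).map
          (fun z => inner ℝ z (Matrix.toEuclideanLin A z)) =
        (Measure.pi fun _ : Fin A.rank => chiSqOne).map (fun w => ∑ j, Λ j * w j) := by
  have hcard : Fintype.card {i // hA.eigenvalues i ≠ 0} = A.rank :=
    hA.rank_eq_card_non_zero_eigs.symm
  set e : Fin A.rank ≃ {i // hA.eigenvalues i ≠ 0} := (Fintype.equivFinOfCardEq hcard).symm with he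
  set b := hA.eigenvectorBasis with hb
  refine ⟨fun j => hA.eigenvalues (e j), ?_, ?_⟩
  · have h1 : Finset.univ.val.map (fun j => hA.eigenvalues (e j)) =
        (Finset.univ.val.map fun i : {i // hA.eigenvalues i ≠ 0} => i.1).map hA.eigenvalues := by
      rw [← Finset.map_univ_equiv e, Finset.map_val, Multiset.map_map, Multiset.map_map]
      rfl
    have h2 : (Finset.univ.val.map fun i : {i // hA.eigenvalues i ≠ 0} => i.1) =
        Finset.univ.val.filter (fun i => hA.eigenvalues i ≠ 0) := by
      have h3 : Finset.univ.map (Function.Embedding.subtype fun i => hA.eigenvalues i ≠ 0) =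
          Finset.univ.filter fun i => hA.eigenvalues i ≠ 0 := by
        ext i
        simp
      exact congrArg Finset.val h3
    rw [h1, h2, hA.roots_charpoly_eq_eigenvalues, Multiset.filter_map]
    rfl
  · have hmeas : Measurable fun z : EuclideanSpace ℝ ι =>
        inner ℝ z (Matrix.toEuclideanLin A z) :=
      (continuous_id.inner (Matrix.toEuclideanLin A).continuous_of_finiteDimensional).measurable
    have hquad : ∀ x : ι → ℝ, inner ℝ (∑ i, x i • b i)
        (Matrix.toEuclideanLin A (∑ i, x i • b i)) =
          ∑ j, hA.eigenvalues (e j) * x (e j) ^ 2 := by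
      intro x
      have hT : Matrix.toEuclideanLin A (∑ i, x i • b i) =
          ∑ i, (x i * hA.eigenvalues i) • b i := by
        rw [map_sum]
        refine Finset.sum_congr rfl fun i _ => ?_
        rw [map_smul, Matrix.toLpLin_apply, hb, hA.mulVec_eigenvectorBasis, mul_smul]
        rfl
      rw [hT, sum_inner]
      have h1 : ∀ i, inner ℝ (x i • b i) (∑ i, (x i * hA.eigenvalues i) • b i) =
          hA.eigenvalues i * x i ^ 2 := by
        intro i
        rw [inner_smul_left, b.orthonormal.inner_right_fintype]
        simp only [conj_trivial]
        ring
      simp_rw [h1]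
      rw [Equiv.sum_comp e (fun i : {i // hA.eigenvalues i ≠ 0} => hA.eigenvalues i * x i ^ 2)]
      rw [← Finset.sum_subtype (Finset.univ.filter fun i => hA.eigenvalues i ≠ 0) (by simp)
        (fun i => hA.eigenvalues i * x i ^ 2)]
      refine (Finset.sum_filter_of_ne fun i _ hi => ?_).symm
      exact left_ne_zero_of_mul hi
    rw [stdGaussian_eq_map_pi_orthonormalBasis b, Measure.map_map hmeas (by fun_prop),
      ← map_pi_gaussianReal_sq (φ := fun j => (e j : ι))
        (Subtype.val_injective.comp e.injective), Measure.map_map (by fun_prop) (by fun_prop)]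
    congr 1
    ext x
    exact hquad x

lemma tendstoInDistribution_of_map_eq {Ω Ω' Ω'' E : Type*} [MeasurableSpace Ω]
    [MeasurableSpace Ω'] [MeasurableSpace Ω''] [TopologicalSpace E] [MeasurableSpace E]
    [OpensMeasurableSpace E] {P : Measure Ω} {P' : Measure Ω'} {P'' : Measure Ω''}
    [IsProbabilityMeasure P] [IsProbabilityMeasure P'] [IsProbabilityMeasure P'']
    {X : ℕ → Ω → E} {Z : Ω' → E} {W : Ω'' → E}
    (h : TendstoInDistribution X atTop Z (fun _ => P) P') (hW : AEMeasurable W P'')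
    (hZW : P'.map Z = P''.map W) : TendstoInDistribution X atTop W (fun _ => P) P'' := by
  refine ⟨h.forall_aemeasurable, hW, ?_⟩
  have : (⟨P''.map W, Measure.isProbabilityMeasure_map hW⟩ : ProbabilityMeasure E) =
      ⟨P'.map Z, Measure.isProbabilityMeasure_map h.aemeasurable_limit⟩ := Subtype.ext hZW.symm
  rw [this]
  exact h.tendsto

/-! ### The blocks of the estimating equations -/

section Blocks

variable {p q : ℕ}

/-- The projection of `ℝ^(p + q)` onto the coordinates of the candidate model. -/
noncomputable def headProj (p q : ℕ) :
    EuclideanSpace ℝ (Fin p ⊕ Fin q) →L[ℝ] EuclideanSpace ℝ (Fin p) :=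
  LinearMap.toContinuousLinearMap
    { toFun := fun v => WithLp.toLp 2 fun i => v (Sum.inl i)
      map_add' := fun _ _ => rfl
      map_smul' := fun _ _ => rfl }

@[simp]
lemma headProj_apply (v : EuclideanSpace ℝ (Fin p ⊕ Fin q)) (i : Fin p) :
    headProj p q v i = v (Sum.inl i) := rfl

variable {Ω 𝒟 : Type*}
  {g₁ : 𝒟 → EuclideanSpace ℝ (Fin p ⊕ Fin q) → EuclideanSpace ℝ (Fin p)}
  {g₂ : 𝒟 → EuclideanSpace ℝ (Fin p ⊕ Fin q) → EuclideanSpace ℝ (Fin q)}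
  {γ₀ : EuclideanSpace ℝ (Fin p)}

lemma headProj_fullEq (d : 𝒟) (γ : EuclideanSpace ℝ (Fin p)) :
    headProj p q (fullEq g₁ g₂ d γ) = insideEq g₁ d γ := rfl

lemma headProj_rootMean (D : ℕ → Ω → 𝒟) (γ : EuclideanSpace ℝ (Fin p)) (n : ℕ) (ω : Ω) :
    headProj p q (rootMean (fullEq g₁ g₂) D γ n ω) = rootMean (insideEq g₁) D γ n ω := by
  simp only [rootMean, map_smul, map_sum, headProj_fullEq]

variable [MeasurableSpace 𝒟] {ν : Measure 𝒟}

lemma headProj_meanJacobian (hreg : Regular ν (fullEq g₁ g₂) γ₀) (v : EuclideanSpace ℝ (Fin p)) :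
    headProj p q (Matrix.toEuclideanLin (meanJacobian ν (fullEq g₁ g₂) γ₀) v) =
      Matrix.toEuclideanLin (meanJacobian ν (insideEq g₁) γ₀) v := by
  have hJ : ∀ i j, meanJacobian ν (insideEq g₁) γ₀ i j =
      meanJacobian ν (fullEq g₁ g₂) γ₀ (Sum.inl i) j := by
    intro i j
    obtain ⟨r, hr, K, hK, henv⟩ := hreg.exists_envelope
    refine integral_congr_ae ?_
    filter_upwards [henv] with d hd
    have h1 : HasFDerivAt (insideEq g₁ d)
        ((headProj p q).comp (fderiv ℝ (fullEq g₁ g₂ d) γ₀)) γ₀ :=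
      (headProj p q).hasFDerivAt.comp γ₀ hd.2.1.hasFDerivAt
    rw [h1.fderiv]
    rfl
  ext i
  simp only [headProj_apply, Matrix.toLpLin_apply, Matrix.mulVec, dotProduct, hJ]

lemma sigmaStar_apply (v : EuclideanSpace ℝ (Fin p ⊕ Fin q)) :
    Matrix.toEuclideanLin (sigmaStar ν g₁ g₂ γ₀) v =
      v - Matrix.toEuclideanLin (meanJacobian ν (fullEq g₁ g₂) γ₀)
        (Matrix.toEuclideanLin (meanJacobian ν (insideEq g₁) γ₀)⁻¹ (headProj p q v)) := by
  ext k
  simp only [sigmaStar, Matrix.toLpLin_apply, Matrix.sub_mulVec, Matrix.one_mulVec,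
    Matrix.fromCols_mulVec, Matrix.zero_mulVec, add_zero, PiLp.sub_apply, Pi.sub_apply,
    Matrix.mulVec_mulVec]
  rfl

lemma isHermitian_omegaMatrix (hS : (secondMoment ν (fullEq g₁ g₂) γ₀).PosDef) :
    (omegaMatrix ν g₁ g₂ γ₀).IsHermitian := by
  have h1 : (CFC.sqrt (secondMoment ν (fullEq g₁ g₂) γ₀)).IsHermitian :=
    (CFC.sqrt_nonneg _).isSelfAdjoint
  have h2 := hS.isHermitian.inv
  rw [Matrix.IsHermitian, Matrix.conjTranspose_eq_transpose_of_trivial] at h1 h2 ⊢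
  simp only [omegaMatrix, Matrix.transpose_mul, Matrix.transpose_transpose, h1, h2,
    Matrix.mul_assoc]

lemma inner_omegaMatrix (z : EuclideanSpace ℝ (Fin p ⊕ Fin q)) :
    inner ℝ z (Matrix.toEuclideanLin (omegaMatrix ν g₁ g₂ γ₀) z) =
      inner ℝ (Matrix.toEuclideanLin (secondMoment ν (fullEq g₁ g₂) γ₀)⁻¹
          (Matrix.toEuclideanLin (sigmaStar ν g₁ g₂ γ₀)
            (Matrix.toEuclideanCLM (𝕜 := ℝ) (CFC.sqrt (secondMoment ν (fullEq g₁ g₂) γ₀)) z)))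
        (Matrix.toEuclideanLin (sigmaStar ν g₁ g₂ γ₀)
          (Matrix.toEuclideanCLM (𝕜 := ℝ) (CFC.sqrt (secondMoment ν (fullEq g₁ g₂) γ₀)) z)) := by
  have h1 : (CFC.sqrt (secondMoment ν (fullEq g₁ g₂) γ₀)).transpose =
      CFC.sqrt (secondMoment ν (fullEq g₁ g₂) γ₀) := by
    rw [← Matrix.conjTranspose_eq_transpose_of_trivial]
    exact (CFC.sqrt_nonneg _).isSelfAdjoint
  have hin : ∀ v w : EuclideanSpace ℝ (Fin p ⊕ Fin q), inner ℝ v w = w.ofLp ⬝ᵥ v.ofLp := by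
    intro v w
    simp [PiLp.inner_apply, dotProduct]
  have h2 : ∀ v, Matrix.vecMul v (CFC.sqrt (secondMoment ν (fullEq g₁ g₂) γ₀)) =
      (CFC.sqrt (secondMoment ν (fullEq g₁ g₂) γ₀)).mulVec v := by
    intro v
    conv_lhs => rw [← h1, Matrix.vecMul_transpose]
  rw [hin, hin, omegaMatrix]
  simp only [Matrix.toLpLin_apply, Matrix.ofLp_toEuclideanCLM, ← Matrix.mulVec_mulVec]
  rw [dotProduct_comm, Matrix.dotProduct_mulVec, h2, Matrix.dotProduct_mulVec,
    Matrix.vecMul_transpose]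

end Blocks

/-! ### The limit theorem -/

section Limit

variable {Ω 𝒟 : Type*} [MeasurableSpace Ω] [MeasurableSpace 𝒟] {p q : ℕ}
  {P : Measure Ω} {ν : Measure 𝒟} {D : ℕ → Ω → 𝒟}
  {g₁ : 𝒟 → EuclideanSpace ℝ (Fin p ⊕ Fin q) → EuclideanSpace ℝ (Fin p)}
  {g₂ : 𝒟 → EuclideanSpace ℝ (Fin p ⊕ Fin q) → EuclideanSpace ℝ (Fin q)}
  {γ₀ : EuclideanSpace ℝ (Fin p)} {γhat : ℕ → Ω → EuclideanSpace ℝ (Fin p)}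

lemma linearExpansion_iff : LinearExpansion P ν D g₁ γ₀ γhat ↔
    TendstoInMeasure P (fun (n : ℕ) ω => Real.sqrt n • (γhat n ω - γ₀) +
      Matrix.toEuclideanLin (meanJacobian ν (insideEq g₁) γ₀)⁻¹
        (rootMean (insideEq g₁) D γ₀ n ω)) atTop (fun _ => 0) := by
  simp only [LinearExpansion, rootMean, smul_add, map_smul]

variable [IsProbabilityMeasure P]

/-- On the event that the inside equations are solved, their expansion at the estimator is a linear
equation for the estimation error. -/
theorem linearExpansion_of_solves (hlaw : ∀ i, HasLaw (D i) ν P) (hindep : iIndepFun D P)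
    (hmeas : Measurable fun x : 𝒟 × EuclideanSpace ℝ (Fin p) => fullEq g₁ g₂ x.1 x.2)
    (hreg : Regular ν (fullEq g₁ g₂) γ₀) (hA : IsUnit (meanJacobian ν (insideEq g₁) γ₀).det)
    (hsol : Tendsto (fun n : ℕ => P {ω | ∑ i : Fin n, insideEq g₁ (D i ω) (γhat n ω) ≠ 0})
      atTop (𝓝 0))
    (hb : BoundedInProbability P (fun n ω => Real.sqrt n • (γhat n ω - γ₀))) :
    LinearExpansion P ν D g₁ γ₀ γhat := by
  set A := meanJacobian ν (insideEq g₁) γ₀ with hAdef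
  set R : ℕ → Ω → EuclideanSpace ℝ (Fin p ⊕ Fin q) := fun n ω =>
    rootMean (fullEq g₁ g₂) D (γhat n ω) n ω - rootMean (fullEq g₁ g₂) D γ₀ n ω -
      Matrix.toEuclideanLin (meanJacobian ν (fullEq g₁ g₂) γ₀)
        (Real.sqrt n • (γhat n ω - γ₀)) with hR
  have hRop : TendstoInMeasure P R atTop (fun _ => 0) :=
    tendstoInMeasure_rootMean_sub hlaw hindep hmeas hreg hb
  set X : ℕ → Ω → EuclideanSpace ℝ (Fin p) := fun n ω =>
    ((Matrix.toEuclideanLin A⁻¹).toContinuousLinearMap.comp (headProj p q)) (R n ω) with hX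
  have hexp : TendstoInMeasure P X atTop (fun _ => 0) := tendstoInMeasure_zero_clm hRop _
  have ha := tendstoInMeasure_zero_norm hexp
  rw [linearExpansion_iff]
  have hG : Tendsto (fun n : ℕ => P {ω | ∑ i : Fin n, insideEq g₁ (D i ω) (γhat n ω) = 0}ᶜ)
      atTop (𝓝 0) := hsol
  refine tendstoInMeasure_zero_of_control (a := fun n ω => ‖X n ω‖)
    (G := fun n => {ω | ∑ i : Fin n, insideEq g₁ (D i ω) (γhat n ω) = 0})
    ha (boundedInProbability_of_tendstoInMeasure ha) hG ?_
  intro B ε hε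
  refine ⟨ε, hε, Eventually.of_forall fun n => ae_of_all _ fun ω hG hlt _ => ?_⟩
  rw [abs_norm] at hlt
  refine lt_of_eq_of_lt ?_ hlt
  have h0 : rootMean (insideEq g₁) D (γhat n ω) n ω = 0 := by
    have hG' : ∑ i : Fin n, insideEq g₁ (D i ω) (γhat n ω) = 0 := hG
    rw [rootMean, hG', smul_zero, smul_zero]
  have hinv : ∀ v, Matrix.toEuclideanLin A⁻¹ (Matrix.toEuclideanLin A v) = v := by
    intro v
    simp only [Matrix.toLpLin_apply, Matrix.mulVec_mulVec]
    rw [Matrix.nonsing_inv_mul _ hA, Matrix.one_mulVec]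
  have hXω : X n ω = -(Real.sqrt n • (γhat n ω - γ₀) +
      Matrix.toEuclideanLin A⁻¹ (rootMean (insideEq g₁) D γ₀ n ω)) := by
    have hproj : headProj p q (R n ω) = -(rootMean (insideEq g₁) D γ₀ n ω) -
        Matrix.toEuclideanLin A (Real.sqrt n • (γhat n ω - γ₀)) := by
      simp only [hR]
      rw [map_sub, map_sub, headProj_rootMean, headProj_rootMean, headProj_meanJacobian hreg, h0,
        zero_sub]
    simp only [hX, ContinuousLinearMap.comp_apply, LinearMap.coe_toContinuousLinearMap']
    rw [hproj, map_sub, hinv, map_neg]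
    abel
  rw [hXω, norm_neg]

/-- The limit law of the likelihood ratio: the estimating equations at the estimator are
`Σ_*` times those at the true parameter, up to `o_p(1)`. -/
theorem tendstoInDistribution_two_mul_negLogEL (hlaw : ∀ i, HasLaw (D i) ν P)
    (hindep : iIndepFun D P)
    (hmeas : Measurable fun x : 𝒟 × EuclideanSpace ℝ (Fin p) => fullEq g₁ g₂ x.1 x.2)
    (hreg : Regular ν (fullEq g₁ g₂) γ₀) (hγhat : ∀ n, AEMeasurable (γhat n) P)
    {lamhat : ℕ → Ω → EuclideanSpace ℝ (Fin p ⊕ Fin q)}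
    (hlam_meas : ∀ n, AEMeasurable (lamhat n) P)
    (hlam : ∀ n, ∀ᵐ ω ∂P,
      (∃ lam, IsMultiplier (fun i : Fin n => fullEq g₁ g₂ (D i ω) (γhat n ω)) lam) →
        IsMultiplier (fun i : Fin n => fullEq g₁ g₂ (D i ω) (γhat n ω)) (lamhat n ω))
    (hlin : LinearExpansion P ν D g₁ γ₀ γhat) :
    TendstoInDistribution
      (fun n ω => 2 * negLogEL (fun i : Fin n => fullEq g₁ g₂ (D i ω) (γhat n ω)) (lamhat n ω))
      atTop (fun z => inner ℝ z (Matrix.toEuclideanLin (omegaMatrix ν g₁ g₂ γ₀) z))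
      (fun _ => P) (stdGaussian (EuclideanSpace ℝ (Fin p ⊕ Fin q))) := by
  have hν : IsProbabilityMeasure ν := (hlaw 0).isProbabilityMeasure_iff.1 inferInstance
  rw [linearExpansion_iff] at hlin
  set Ainv := (Matrix.toEuclideanLin (meanJacobian ν (insideEq g₁) γ₀)⁻¹).toContinuousLinearMap
    with hAinv
  set J := (Matrix.toEuclideanLin (meanJacobian ν (fullEq g₁ g₂) γ₀)).toContinuousLinearMap with hJ
  set Sst := (Matrix.toEuclideanLin (sigmaStar ν g₁ g₂ γ₀)).toContinuousLinearMap with hSst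
  set Sinv := (Matrix.toEuclideanLin
    (secondMoment ν (fullEq g₁ g₂) γ₀)⁻¹).toContinuousLinearMap with hSinv
  set Z := rootMean (fullEq g₁ g₂) D γ₀ with hZ
  set u : ℕ → Ω → EuclideanSpace ℝ (Fin p ⊕ Fin q) :=
    fun n ω => rootMean (fullEq g₁ g₂) D (γhat n ω) n ω with hu
  set h : ℕ → Ω → EuclideanSpace ℝ (Fin p) := fun n ω => Real.sqrt n • (γhat n ω - γ₀) with hh
  have hdata : ∀ n i, AEMeasurable (fun ω => fullEq g₁ g₂ (D i ω) (γhat n ω)) P := fun n i =>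
    hmeas.comp_aemeasurable ((hlaw i).aemeasurable.prodMk (hγhat n))
  have humeas : ∀ n, AEMeasurable (u n) P := by
    intro n
    have : AEMeasurable (fun ω => ∑ i : Fin n, fullEq g₁ g₂ (D i ω) (γhat n ω)) P :=
      Finset.aemeasurable_fun_sum _ fun i _ => hdata n i
    simp only [hu, rootMean]
    fun_prop
  have hclt : TendstoInDistribution Z atTop
      (fun z => Matrix.toEuclideanCLM (𝕜 := ℝ)
        (CFC.sqrt (secondMoment ν (fullEq g₁ g₂) γ₀)) z) (fun _ => P) (stdGaussian _) :=
    tendstoInDistribution_sqrt_smul_mean hlaw hindep (hreg.memLp_two hmeas) hreg.mean_zero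
      hreg.posDef.posSemidef fun _ _ => rfl
  have hZb := boundedInProbability_of_tendstoInDistribution hclt
  -- the linear expansion makes the estimator root-n consistent
  set E : ℕ → Ω → EuclideanSpace ℝ (Fin p) :=
    fun n ω => h n ω + Ainv (headProj p q (Z n ω)) with hE
  have hEop : TendstoInMeasure P E atTop (fun _ => 0) := by
    simp only [← headProj_rootMean (g₂ := g₂)] at hlin
    exact hlin
  have hb : BoundedInProbability P h := by
    have h1 := (boundedInProbability_of_tendstoInMeasure hEop).add
      ((hZb.clm (headProj p q)).clm (-Ainv))
    simpa [hE] using h1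
  have hR := tendstoInMeasure_rootMean_sub hlaw hindep hmeas hreg hb
  have hdiff : TendstoInMeasure P (fun n ω => u n ω - Sst (Z n ω)) atTop (fun _ => 0) := by
    refine (tendstoInMeasure_zero_add hR (tendstoInMeasure_zero_clm hEop J)).congr_left fun n => ?_
    refine ae_of_all _ fun ω => ?_
    have h1 : Sst (Z n ω) = Z n ω - J (Ainv (headProj p q (Z n ω))) := sigmaStar_apply _
    have h2 : J (E n ω) = J (h n ω) + J (Ainv (headProj p q (Z n ω))) := map_add _ _ _
    have h3 : Matrix.toEuclideanLin (meanJacobian ν (fullEq g₁ g₂) γ₀) (h n ω) = J (h n ω) := rfl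
    beta_reduce
    rw [h1, h2, h3]
    abel
  have hud : TendstoInDistribution u atTop
      (fun z => Sst (Matrix.toEuclideanCLM (𝕜 := ℝ)
        (CFC.sqrt (secondMoment ν (fullEq g₁ g₂) γ₀)) z)) (fun _ => P) (stdGaussian _) :=
    tendstoInDistribution_of_tendstoInMeasure_sub u _ (hclt.continuous_comp Sst.continuous)
      hdiff humeas
  have hq := tendstoInMeasure_two_mul_negLogEL_sub hlaw hindep hmeas hreg hb
    (boundedInProbability_of_tendstoInDistribution hud) hlam
  have hquad : TendstoInDistribution (fun n ω => inner ℝ (Sinv (u n ω)) (u n ω)) atTop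
      (fun z => inner ℝ z (Matrix.toEuclideanLin (omegaMatrix ν g₁ g₂ γ₀) z))
      (fun _ => P) (stdGaussian _) := by
    simp only [inner_omegaMatrix]
    exact hud.continuous_comp (g := fun v => inner ℝ (Sinv v) v)
      (Sinv.continuous.inner continuous_id)
  refine tendstoInDistribution_of_tendstoInMeasure_sub _ _ hquad hq fun n => ?_
  unfold negLogEL
  refine (Finset.aemeasurable_fun_sum _ fun i _ => ?_).const_mul _
  exact Real.measurable_log.comp_aemeasurable
    (((hlam_meas n).inner (hdata n i)).const_add 1)

end Limit
end ELCIC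

theorem corollary1 {Ω 𝒟 : Type*} [MeasurableSpace Ω] [MeasurableSpace 𝒟]
    (P : Measure Ω) [IsProbabilityMeasure P]
    -- the data: an i.i.d. sequence with law `ν`
    (ν : Measure 𝒟) (D : ℕ → Ω → 𝒟) (hlaw : ∀ i, HasLaw (D i) ν P) (hindep : iIndepFun D P)
    -- the estimating functions, with `p + q = L`
    {p q : ℕ} (hp : 0 < p)
    (g₁ : 𝒟 → EuclideanSpace ℝ (Fin p ⊕ Fin q) → EuclideanSpace ℝ (Fin p))
    (g₂ : 𝒟 → EuclideanSpace ℝ (Fin p ⊕ Fin q) → EuclideanSpace ℝ (Fin q))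
    (hmeas : Measurable fun x : 𝒟 × EuclideanSpace ℝ (Fin p) => fullEq g₁ g₂ x.1 x.2)
    -- the true parameter
    (γ₀ : EuclideanSpace ℝ (Fin p)) (hreg : Regular ν (fullEq g₁ g₂) γ₀)
    (hA : IsUnit (meanJacobian ν (insideEq g₁) γ₀).det)
    -- the plug-in estimator
    (γhat : ℕ → Ω → EuclideanSpace ℝ (Fin p)) (hγhat : ∀ n, AEMeasurable (γhat n) P)
    -- the Lagrange multiplier estimator, a solution whenever there is one
    (lamhat : ℕ → Ω → EuclideanSpace ℝ (Fin p ⊕ Fin q))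
    (hlam_meas : ∀ n, AEMeasurable (lamhat n) P)
    (hlam : ∀ n, ∀ᵐ ω ∂P,
      (∃ lam, IsMultiplier (fun i : Fin n => fullEq g₁ g₂ (D i ω) (γhat n ω)) lam) →
        IsMultiplier (fun i : Fin n => fullEq g₁ g₂ (D i ω) (γhat n ω)) (lamhat n ω)) :
    -- a root-n consistent solution of the equations given by `g₁` has the linear expansion
    (Tendsto (fun n : ℕ => P {ω | ∑ i : Fin n, insideEq g₁ (D i ω) (γhat n ω) ≠ 0})
        atTop (𝓝 0) →
      BoundedInProbability P (fun n ω => Real.sqrt n • (γhat n ω - γ₀)) →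
      LinearExpansion P ν D g₁ γ₀ γhat) ∧
    -- under the linear expansion, `2 l` converges in distribution to `∑ⱼ Λⱼ χ²₁`
    (LinearExpansion P ν D g₁ γ₀ γhat →
      ∃ Λ : Fin (omegaMatrix ν g₁ g₂ γ₀).rank → ℝ,
        Finset.univ.val.map Λ =
          (omegaMatrix ν g₁ g₂ γ₀).charpoly.roots.filter (fun x => x ≠ 0) ∧
        TendstoInDistribution
          (fun n ω => 2 * negLogEL
            (fun i : Fin n => fullEq g₁ g₂ (D i ω) (γhat n ω)) (lamhat n ω))
          atTop
          (fun w : Fin (omegaMatrix ν g₁ g₂ γ₀).rank → ℝ => ∑ j, Λ j * w j)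
          (fun _ => P) (Measure.pi fun _ => chiSqOne)) := by
  refine ⟨linearExpansion_of_solves hlaw hindep hmeas hreg hA, fun hlin => ?_⟩
  obtain ⟨Λ, hΛ, hmap⟩ := exists_map_stdGaussian_inner_eq (isHermitian_omegaMatrix hreg.posDef)
  exact ⟨Λ, hΛ, tendstoInDistribution_of_map_eq
    (tendstoInDistribution_two_mul_negLogEL hlaw hindep hmeas hreg hγhat hlam_meas hlam hlin)
    (Finset.measurable_fun_sum _ fun j _ => (measurable_pi_apply j).const_mul _).aemeasurable hmap⟩
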